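/- Let $y=\theta^*+\epsilon$, where $\theta^*\in\mathbb R^{n\times n}$ is deterministic and the entries of $\epsilon$ are i.i.d. with mean $0$ and sub-Gaussian norm $\sigma=\inf\{t>0:\mathbb E\,e^{\epsilon_{ij}^2/t^2}\le 2\}<\infty$. Write $\|\cdot\|$ for the Frobenius norm, $|\theta^*|_\infty=\max_{i,j}|\theta^*_{ij}|$, and $\sigma_1(\theta^*)\ge\dots\ge\sigma_n(\theta^*)$ for the singular values of $\theta^*$. For a matrix $M=\sum_i s_iu_iv_i^{t}$ (singular value decomposition) and $\lambda\ge 0$ let $\mathrm{SVT}_\lambda(M)=\sum_{i:\,|s_i|>\lambda}s_iu_iv_i^{t}$, and put $\hat\theta^{(\lambda)}=\mathrm{SVT}_\lambda(y)$. The cross-validated estimator $\hat\theta_{CVSVT}$ with grid $\Lambda=\{1,2,2^2,\dots,2^{N^*}\}$ is defined as follows. Put each index $(i,j)\in[n]\times[n]$ into $I_1$ or $I_2=I_1^c$ with probability $1/2$ each, independently over the indices and of $\epsilon$. For $I\in\{I_1,I_2\}$ let $\tilde y(I)$ be the matrix with entries $2y_{ij}$ for $(i,j)\in I$ and $0$ for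 $(i,j)\notin I$, and let $\hat\theta^{(\lambda,I)}=\mathrm{SVT}_\lambda(\tilde y(I))$. For $j=1,2$ let $\hat\lambda_j\in\arg\min_{\lambda\in\Lambda}\|y_{I_j}-\hat\theta^{(\lambda,I_j^c)}_{I_j}\|^2$, let $\tilde\theta$ be the matrix with $\tilde\theta_{I_j}=\hat\theta^{(\hat\lambda_j,I_j^c)}_{I_j}$ for $j=1,2$, let $\hat\lambda\in\arg\min_{\lambda\in\Lambda}\|\hat\theta^{(\lambda)}-\tilde\theta\|^2$, and set $\hat\theta_{CVSVT}=\hat\theta^{(\hat\lambda)}$ (ties are broken arbitrarily). For every $c>0$ there is a constant $C>0$ depending only on $c$ (so for $c=1$ an absolute constant) such that the following holds for all $\delta>0$, $n$, $N^*$, $\theta^*$ and all error distributions as above. If $$c\le(|\theta^*|_\infty+\sigma)\sqrt n\qquad\text{and}\qquad 2^{N^*}>C\,(|\theta^*|_\infty+\sigma)\sqrt n,$$ then with probability at least $1-2e^{-n}-\delta$ (over $\epsilon$ and the random folds), $$\frac{\|\hat\theta_{CVSVT}-\theta^*\|^2}{n^2}\le\frac{C}{n^2}\sum_{j=1}^n\min\{n(|\theta^*|_\infty+\sigma)^2,\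 \sigma_j^2(\theta^*)\}+\frac{C}{n^2}\,\sigma^2\log(N^*/\delta).$$ -/

import Mathlib

open MeasureTheory ProbabilityTheory
open scoped ENNReal

noncomputable section

namespace CVSVT

/-- `y = ∑ i, s i • u i (v i)ᵀ` with `s i ≥ 0` and orthonormal bases `u`, `v` of `ℝⁿ`:
a singular value decomposition of the square matrix `y`. -/
structure IsSVD {n : ℕ} (y : Matrix (Fin n) (Fin n) ℝ) (s : Fin n → ℝ)
    (u v : OrthonormalBasis (Fin n) ℝ (EuclideanSpace ℝ (Fin n))) : Prop where
  nonneg : ∀ i, 0 ≤ s i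
  eq_sum : y = ∑ i, s i • Matrix.vecMulVec (u i).ofLp (v i).ofLp

/-- `∑_{i : s i > t} s i • u i (v i)ᵀ`, the part of a decomposition above the threshold `t`. -/
def truncatedSum {n : ℕ} (t : ℝ) (s : Fin n → ℝ)
    (u v : OrthonormalBasis (Fin n) ℝ (EuclideanSpace ℝ (Fin n))) : Matrix (Fin n) (Fin n) ℝ :=
  ∑ i with t < |s i|, s i • Matrix.vecMulVec (u i).ofLp (v i).ofLp

theorem toEuclideanLin_sum {n : ℕ} (S : Finset (Fin n)) (s : Fin n → ℝ)
    (u v : OrthonormalBasis (Fin n) ℝ (EuclideanSpace ℝ (Fin n)))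
    (x : EuclideanSpace ℝ (Fin n)) :
    Matrix.toEuclideanLin (∑ i ∈ S, s i • Matrix.vecMulVec (u i).ofLp (v i).ofLp) x
      = ∑ i ∈ S, (s i * inner ℝ (v i) x) • u i := by
  rw [map_sum, LinearMap.sum_apply]
  refine Finset.sum_congr rfl fun i _ => ?_
  rw [map_smul, LinearMap.smul_apply, mul_smul]
  congr 1
  ext k
  simp [Matrix.toLpLin_apply, Matrix.vecMulVec_mulVec, PiLp.inner_apply, dotProduct,
    mul_comm]

theorem exists_isSVD {n : ℕ} (y : Matrix (Fin n) (Fin n) ℝ) :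
    ∃ s u v, IsSVD y s u v := by
  set T := Matrix.toEuclideanLin y with hTdef
  have hn : Module.finrank ℝ (EuclideanSpace ℝ (Fin n)) = n := by simp
  have hT := T.isSymmetric_adjoint_comp_self
  set v := hT.eigenvectorBasis hn with hv
  set s : Fin n → ℝ := fun i => √(hT.eigenvalues hn i) with hs
  have hs2 : ∀ i, s i * s i = hT.eigenvalues hn i := fun i =>
    Real.mul_self_sqrt (T.isPositive_adjoint_comp_self.nonneg_eigenvalues hn i)
  have hin : ∀ i j, inner ℝ (T (v i)) (T (v j)) = if i = j then s i * s i else 0 := by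
    intro i j
    rw [← LinearMap.adjoint_inner_right, ← LinearMap.comp_apply, hT.apply_eigenvectorBasis hn j,
      inner_smul_right, orthonormal_iff_ite.mp v.orthonormal i j]
    split_ifs with h
    · subst h; simp [hs2]
    · simp
  have hort : Orthonormal ℝ (Set.domRestrict {i | s i ≠ 0} fun i => (s i)⁻¹ • T (v i)) := by
    rw [orthonormal_iff_ite]
    rintro ⟨i, hi⟩ ⟨j, hj⟩
    have hi' : s i ≠ 0 := hi
    simp only [Set.domRestrict_apply, inner_smul_left, inner_smul_right, hin, Subtype.mk.injEq]
    split_ifs with h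
    · subst h; simp; field_simp
    · simp
  obtain ⟨u, hu⟩ := hort.exists_orthonormalBasis_extension_of_card_eq (by simp)
  have key : ∀ i, T (v i) = s i • u i := by
    intro i
    by_cases h : s i = 0
    · have : inner ℝ (T (v i)) (T (v i)) = 0 := by rw [hin]; simp [h]
      rw [inner_self_eq_zero.mp this, h, zero_smul]
    · rw [hu i h, smul_smul, mul_inv_cancel₀ h, one_smul]
  refine ⟨s, u, v, fun i => Real.sqrt_nonneg _, ?_⟩
  apply Matrix.toEuclideanLin.injective
  refine v.toBasis.ext fun j => ?_
  rw [OrthonormalBasis.coe_toBasis, toEuclideanLin_sum]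
  simp [orthonormal_iff_ite.mp v.orthonormal, ← hTdef, key]

/-- Singular value thresholding: with `y = ∑ i, s i • u i (v i)ᵀ` a singular value decomposition,
keep the terms with `|s i| > t`. The choice of the decomposition is immaterial, see
`svt_eq_truncatedSum`. -/
def svt {n : ℕ} (t : ℝ) (y : Matrix (Fin n) (Fin n) ℝ) : Matrix (Fin n) (Fin n) ℝ :=
  truncatedSum t (exists_isSVD y).choose (exists_isSVD y).choose_spec.choose
    (exists_isSVD y).choose_spec.choose_spec.choose

theorem truncatedSum_unique {n : ℕ} (t : ℝ) {y : Matrix (Fin n) (Fin n) ℝ} {s s' : Fin n → ℝ}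
    {u v u' v' : OrthonormalBasis (Fin n) ℝ (EuclideanSpace ℝ (Fin n))}
    (h : IsSVD y s u v) (h' : IsSVD y s' u' v') :
    truncatedSum t s u v = truncatedSum t s' u' v' := by
  have gen : ∀ {s : Fin n → ℝ} {u v : OrthonormalBasis (Fin n) ℝ (EuclideanSpace ℝ (Fin n))},
      IsSVD y s u v → ∀ i x, inner ℝ (Matrix.toEuclideanLin y (v i)) (Matrix.toEuclideanLin y x)
        = s i ^ 2 * inner ℝ (v i) x := by
    intro s u v h i x
    rw [h.eq_sum, toEuclideanLin_sum, toEuclideanLin_sum]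
    simp only [orthonormal_iff_ite.mp v.orthonormal]
    simp [inner_smul_left, inner_sum, inner_smul_right, orthonormal_iff_ite.mp u.orthonormal]
    ring
  have hz : ∀ i j, inner ℝ (v i) (v' j) ≠ 0 → s i = s' j := by
    intro i j hij
    have h1 := gen h i (v' j)
    have h2 := gen h' j (v i)
    rw [real_inner_comm, h1, real_inner_comm (v i) (v' j)] at h2
    exact (pow_left_inj₀ (h.nonneg i) (h'.nonneg j) two_ne_zero).mp (mul_right_cancel₀ hij h2)
  apply Matrix.toEuclideanLin.injective
  refine v'.toBasis.ext fun j => ?_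
  have e1 := congrArg (fun A => Matrix.toEuclideanLin A (v' j)) (h.eq_sum.symm.trans h'.eq_sum)
  simp only [toEuclideanLin_sum] at e1
  rw [OrthonormalBasis.coe_toBasis, truncatedSum, truncatedSum, toEuclideanLin_sum,
    toEuclideanLin_sum, Finset.sum_filter, Finset.sum_filter]
  have a1 : ∀ i, (if t < |s i| then (s i * inner ℝ (v i) (v' j)) • u i else 0)
      = if t < |s' j| then (s i * inner ℝ (v i) (v' j)) • u i else 0 := by
    intro i
    by_cases h0 : inner ℝ (v i) (v' j) = 0
    · simp [h0]
    · rw [hz i j h0]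
  have a2 : ∀ i, (if t < |s' i| then (s' i * inner ℝ (v' i) (v' j)) • u' i else 0)
      = if t < |s' j| then (s' i * inner ℝ (v' i) (v' j)) • u' i else 0 := by
    intro i
    by_cases h0 : i = j
    · rw [h0]
    · simp [orthonormal_iff_ite.mp v'.orthonormal, h0]
  simp only [a1, a2]
  split_ifs
  · exact e1
  · simp

theorem svt_eq_truncatedSum {n : ℕ} (t : ℝ) {y : Matrix (Fin n) (Fin n) ℝ} {s : Fin n → ℝ}
    {u v : OrthonormalBasis (Fin n) ℝ (EuclideanSpace ℝ (Fin n))} (h : IsSVD y s u v) :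
    svt t y = truncatedSum t s u v :=
  truncatedSum_unique t (exists_isSVD y).choose_spec.choose_spec.choose_spec h

/-- The squared Frobenius norm, `∑ i j, (A i j)²`. -/
def frobSq {n : ℕ} (A : Matrix (Fin n) (Fin n) ℝ) : ℝ := ∑ i, ∑ j, A i j ^ 2

/-- The largest absolute value of an entry. -/
def maxAbs {n : ℕ} (A : Matrix (Fin n) (Fin n) ℝ) : ℝ := ⨆ p : Fin n × Fin n, |A p.1 p.2|

/-- The `j`-th largest singular value, `j = 0, …, n - 1`. -/
def singularValue {n : ℕ} (A : Matrix (Fin n) (Fin n) ℝ) (j : Fin n) : ℝ :=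
  (Matrix.toEuclideanLin A).singularValues j

/-- Zero doubling: double the entries of `y` in the index set `I`, set the others to zero. -/
def zeroDouble {n : ℕ} (I : Set (Fin n × Fin n)) (y : Matrix (Fin n) (Fin n) ℝ) :
    Matrix (Fin n) (Fin n) ℝ :=
  Matrix.of fun i j => I.indicator (fun p => 2 * y p.1 p.2) (i, j)

/-- The completion estimator built from the entries of `y` in the index set `I`. -/
def completion {n : ℕ} (I : Set (Fin n × Fin n)) (t : ℝ) (y : Matrix (Fin n) (Fin n) ℝ) :
    Matrix (Fin n) (Fin n) ℝ :=
  svt t (zeroDouble I y)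

/-- Squared prediction error on the fold `I` of the completion estimator built from the
complement of `I`. -/
def cvError {n : ℕ} (I : Set (Fin n × Fin n)) (y : Matrix (Fin n) (Fin n) ℝ) (t : ℝ) : ℝ :=
  ∑ p : Fin n × Fin n, I.indicator (fun p => (y p.1 p.2 - completion Iᶜ t y p.1 p.2) ^ 2) p

/-- The grid `{1, 2, 2², …, 2^N}`. -/
def grid (N : ℕ) : Set ℝ := {t | ∃ k ≤ N, t = 2 ^ k}

/-- `t` is a minimizer of `f` over `S`. -/
def IsArgmin (f : ℝ → ℝ) (S : Set ℝ) (t : ℝ) : Prop := t ∈ S ∧ IsMinOn f S t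

open Classical in
/-- The matrix that equals `A` on the index set `I` and `B` off it. -/
def glue {n : ℕ} (I : Set (Fin n × Fin n)) (A B : Matrix (Fin n) (Fin n) ℝ) :
    Matrix (Fin n) (Fin n) ℝ :=
  Matrix.of fun i j => if (i, j) ∈ I then A i j else B i j

/-- `est` is a two-fold cross-validated singular value thresholding estimate computed from the
data `y` with the folds `I`, `Iᶜ` and the grid `{1, 2, …, 2^N}`. Ties among minimizers may be
broken in any way. -/
def IsCVSVT {n : ℕ} (N : ℕ) (I : Set (Fin n × Fin n)) (y est : Matrix (Fin n) (Fin n) ℝ) : Prop :=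
  ∃ t₁ t₂ t : ℝ,
    IsArgmin (cvError I y) (grid N) t₁ ∧
    IsArgmin (cvError Iᶜ y) (grid N) t₂ ∧
    IsArgmin (fun r => frobSq (svt r y - glue I (completion Iᶜ t₁ y) (completion I t₂ y)))
      (grid N) t ∧
    est = svt t y

theorem exists_isArgmin (f : ℝ → ℝ) (N : ℕ) : ∃ t, IsArgmin f (grid N) t := by
  have hf : (grid N).Finite :=
    ((Set.finite_Iic N).image fun k => (2 : ℝ) ^ k).subset (by
      rintro t ⟨k, hk, rfl⟩
      exact ⟨k, hk, rfl⟩)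
  obtain ⟨t, ht, hmin⟩ := hf.exists_minimalFor f (grid N) ⟨1, 0, Nat.zero_le _, by simp⟩
  refine ⟨t, ht, fun r hr => ?_⟩
  rcases le_total (f t) (f r) with h | h
  · exact h
  · exact hmin hr h

theorem exists_isCVSVT {n : ℕ} (N : ℕ) (I : Set (Fin n × Fin n))
    (y : Matrix (Fin n) (Fin n) ℝ) : ∃ est, IsCVSVT N I y est := by
  obtain ⟨t₁, h₁⟩ := exists_isArgmin (cvError I y) N
  obtain ⟨t₂, h₂⟩ := exists_isArgmin (cvError Iᶜ y) N
  obtain ⟨t, h⟩ := exists_isArgmin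
    (fun r => frobSq (svt r y - glue I (completion Iᶜ t₁ y) (completion I t₂ y))) N
  exact ⟨_, t₁, t₂, t, h₁, h₂, h, rfl⟩

/-- The sub-Gaussian (`ψ₂`) norm `inf {t > 0 : E exp (X² / t²) ≤ 2}`; it is `∞` exactly when `X` is
not sub-Gaussian. -/
def subGaussianNorm {Ω : Type*} [MeasurableSpace Ω] (X : Ω → ℝ) (μ : Measure Ω) : ℝ≥0∞ :=
  ⨅ (t : ℝ) (_ : 0 < t) (_ : ∫⁻ ω, ENNReal.ofReal (Real.exp (X ω ^ 2 / t ^ 2)) ∂μ ≤ 2),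
    ENNReal.ofReal t

/-- The model on a measure space `(Ω, μ)`: the entries of the noise matrix `ε` are i.i.d. with
mean zero and sub-Gaussian norm `σ`; the entries of the 0-1 matrix `W` are independent fair coins;
`W` is independent of `ε`. -/
structure IsModel {Ω : Type*} [MeasurableSpace Ω] (μ : Measure Ω) {n : ℕ} (σ : ℝ)
    (ε : Fin n → Fin n → Ω → ℝ) (W : Fin n → Fin n → Ω → Bool) : Prop where
  measurable_noise : ∀ i j, Measurable (ε i j)
  measurable_coin : ∀ i j, Measurable (W i j)
  indep_noise : iIndepFun (fun p : Fin n × Fin n => ε p.1 p.2) μ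
  ident_noise : ∀ i j i' j', IdentDistrib (ε i j) (ε i' j') μ μ
  mean_zero : ∀ i j, ∫ ω, ε i j ω ∂μ = 0
  subGaussian : ∀ i j, subGaussianNorm (ε i j) μ = ENNReal.ofReal σ
  indep_coin : iIndepFun (fun p : Fin n × Fin n => W p.1 p.2) μ
  fair_coin : ∀ i j, μ {ω | W i j ω = true} = 1 / 2
  indep : IndepFun (fun ω (p : Fin n × Fin n) => W p.1 p.2 ω)
    (fun ω (p : Fin n × Fin n) => ε p.1 p.2 ω) μ

/-- The first fold: the indices at which the coin shows `true`. -/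
def fold {Ω : Type*} {n : ℕ} (W : Fin n → Fin n → Ω → Bool) (ω : Ω) : Set (Fin n × Fin n) :=
  {p | W p.1 p.2 ω = true}

/-- The observed matrix `θ + ε`. -/
def observed {Ω : Type*} {n : ℕ} (θ : Matrix (Fin n) (Fin n) ℝ) (ε : Fin n → Fin n → Ω → ℝ)
    (ω : Ω) : Matrix (Fin n) (Fin n) ℝ :=
  θ + Matrix.of fun i j => ε i j ω

end CVSVT

end

/-! The first ingredient is stability of thresholding. If `y` lies within `t / 2` of `θ` in operator
norm, then `svt t y` has at most as many nonzero terms as `θ` has singular values above `t / 2`, and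
its distance to `θ` is governed by `∑ min (t², σ_j²)` (`frobSq_svt_sub_le`). A net argument
(`measure_netLarge_le`) shows that with high probability one grid point `t₀`, of order `(|θ|_∞ + σ)
√n`, serves for the full data and for both zero-doubled matrices at once. Zero doubling has error
`±θ` entrywise plus twice the masked noise, so only random signs times `θ` and masked noise have to
be controlled.

The second ingredient is that selection over the grid costs little. Given the folds, the completion
estimators built on one fold are independent of the noise on the other. The noise thus enters the
comparison of two prediction errors through a linear form with frozen coefficients, whose square is
at most `4 σ² L` times the squared norm of those coefficients, outside a small event
(`measure_foldNoiseLarge_le`). With `sum_indicator_sub_sq_le` this gives an oracle inequality on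
each fold.

Finally, the glued matrix is close to `θ`, the selected full-data estimate is no farther from it
than the one at `t₀`, and two triangle inequalities conclude (`cvsvt_error_le`). The independence
arguments go through Fubini, hence the need for measurability of `svt`. -/

namespace CVSVT

open scoped NNReal

/-! ### Sub-Gaussian moment generating functions and tails -/

theorem exp_le_add_exp_sq (x : ℝ) : Real.exp x ≤ x + Real.exp (x ^ 2) := by
  have h2 : x ^ 2 + 1 ≤ Real.exp (x ^ 2) := Real.add_one_le_exp _
  rcases le_total |x| 1 with h | h
  · have := (abs_le.mp (Real.abs_exp_sub_one_sub_id_le h)).2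
    linarith
  · rcases le_abs'.mp h with h' | h'
    · have : Real.exp x ≤ 1 := Real.exp_le_one_iff.mpr (by linarith)
      nlinarith
    · have : Real.exp x ≤ Real.exp (x ^ 2) := Real.exp_le_exp.mpr (by nlinarith)
      linarith

theorem integrable_exp_sq_div {Ω : Type*} [MeasurableSpace Ω] {μ : Measure Ω}
    {X : Ω → ℝ} (hX : Measurable X) {t : ℝ}
    (h : ∫⁻ ω, ENNReal.ofReal (Real.exp (X ω ^ 2 / t ^ 2)) ∂μ ≤ 2) :
    Integrable (fun ω => Real.exp (X ω ^ 2 / t ^ 2)) μ ∧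
      ∫ ω, Real.exp (X ω ^ 2 / t ^ 2) ∂μ ≤ 2 := by
  have hm : AEStronglyMeasurable (fun ω => Real.exp (X ω ^ 2 / t ^ 2)) μ := by
    apply Measurable.aestronglyMeasurable; fun_prop
  have hnn : 0 ≤ᵐ[μ] fun ω => Real.exp (X ω ^ 2 / t ^ 2) := ae_of_all _ fun ω => by positivity
  refine ⟨⟨hm, ?_⟩, ?_⟩
  · rw [hasFiniteIntegral_iff_ofReal hnn]
    exact h.trans_lt (by simp)
  · rw [integral_eq_lintegral_of_nonneg_ae hnn hm]
    exact ENNReal.toReal_le_of_le_ofReal (by norm_num) (by simpa using h)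

theorem integrable_of_integrable_exp_sq_div {Ω : Type*} [MeasurableSpace Ω] {μ : Measure Ω}
    [IsProbabilityMeasure μ] {X : Ω → ℝ} (hX : Measurable X) {t : ℝ} (ht : 0 < t)
    (h : Integrable (fun ω => Real.exp (X ω ^ 2 / t ^ 2)) μ) : Integrable X μ := by
  refine (h.const_mul t).mono' hX.aestronglyMeasurable (ae_of_all _ fun ω => ?_)
  have h1 : |X ω| / t ≤ Real.exp (X ω ^ 2 / t ^ 2) := by
    have h2 := Real.add_one_le_exp (X ω ^ 2 / t ^ 2)
    have h3 : X ω ^ 2 / t ^ 2 = (|X ω| / t) ^ 2 := by rw [div_pow, sq_abs]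
    rw [h3] at h2 ⊢
    nlinarith [sq_nonneg (|X ω| / t - 1)]
  rw [div_le_iff₀ ht] at h1
  rw [Real.norm_eq_abs]
  linarith

theorem exp_mul_le_of_pos (x l : ℝ) {t : ℝ} (ht : 0 < t) :
    Real.exp (l * x) ≤ Real.exp (l ^ 2 * t ^ 2 / 2) * ((1 + Real.exp (x ^ 2 / t ^ 2)) / 2) := by
  have h1 : l * x ≤ l ^ 2 * t ^ 2 / 2 + x ^ 2 / t ^ 2 / 2 := by
    have : x ^ 2 / t ^ 2 = (x / t) ^ 2 := by rw [div_pow]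
    rw [this]
    have h2 : l * x = (l * t) * (x / t) := by field_simp
    rw [h2]
    nlinarith [sq_nonneg (l * t - x / t)]
  refine (Real.exp_le_exp.mpr h1).trans ?_
  rw [Real.exp_add]
  gcongr
  have h3 : Real.exp (x ^ 2 / t ^ 2) = Real.exp (x ^ 2 / t ^ 2 / 2) ^ 2 := by
    rw [← Real.exp_nat_mul]; congr 1; push_cast; ring
  rw [h3]
  nlinarith [sq_nonneg (Real.exp (x ^ 2 / t ^ 2 / 2) - 1)]

theorem exp_mul_le_of_sq_le_one (x : ℝ) {l t : ℝ} (ht : 0 < t) (hl : l ^ 2 * t ^ 2 ≤ 1) :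
    Real.exp (l * x) ≤ l * x + (1 + l ^ 2 * t ^ 2 * (Real.exp (x ^ 2 / t ^ 2) - 1)) := by
  refine (exp_le_add_exp_sq _).trans ?_
  gcongr
  have h1 : Real.exp ((l * x) ^ 2) = Real.exp (x ^ 2 / t ^ 2) ^ (l ^ 2 * t ^ 2) := by
    rw [← Real.exp_mul]; congr 1; field_simp
  have h2 := rpow_one_add_le_one_add_mul_self (s := Real.exp (x ^ 2 / t ^ 2) - 1)
    (by linarith [Real.exp_pos (x ^ 2 / t ^ 2)]) (p := l ^ 2 * t ^ 2) (by positivity) hl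
  rw [h1]
  simpa using h2

/-- For `l² t² ≤ 1`, the inequality `exp z ≤ z + exp (z²)` isolates a linear term that integrates to
zero, and Bernoulli's inequality for the exponent `l² t²` handles the rest. For `l² t² ≥ 1` centring
is not needed: Young's inequality gives a factor `3 / 2`, which `1 + l² t² / 2` absorbs. -/
theorem mgf_le_of_lintegral_exp_sq_le {Ω : Type*} [MeasurableSpace Ω] {μ : Measure Ω}
    [IsProbabilityMeasure μ] {X : Ω → ℝ} (hX : Measurable X) (h0 : ∫ ω, X ω ∂μ = 0) {t : ℝ}
    (ht : 0 < t) (h : ∫⁻ ω, ENNReal.ofReal (Real.exp (X ω ^ 2 / t ^ 2)) ∂μ ≤ 2) (l : ℝ) :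
    Integrable (fun ω => Real.exp (l * X ω)) μ ∧ mgf X μ l ≤ Real.exp (l ^ 2 * t ^ 2) := by
  obtain ⟨hi, hle⟩ := integrable_exp_sq_div hX h
  have hXi := integrable_of_integrable_exp_sq_div hX ht hi
  have hi2 : Integrable (fun ω => Real.exp (l ^ 2 * t ^ 2 / 2) *
      ((1 + Real.exp (X ω ^ 2 / t ^ 2)) / 2)) μ :=
    (((integrable_const (1 : ℝ)).add hi).div_const 2).const_mul _
  have hint : Integrable (fun ω => Real.exp (l * X ω)) μ := by
    refine hi2.mono' (by apply Measurable.aestronglyMeasurable; fun_prop)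
      (ae_of_all _ fun ω => ?_)
    rw [Real.norm_eq_abs, Real.abs_exp]
    exact exp_mul_le_of_pos _ _ ht
  refine ⟨hint, ?_⟩
  rw [mgf]
  rcases le_total (l ^ 2 * t ^ 2) 1 with hl | hl
  · have hi4 : Integrable (fun ω => l ^ 2 * t ^ 2 * (Real.exp (X ω ^ 2 / t ^ 2) - 1)) μ :=
      (hi.sub (integrable_const 1)).const_mul _
    have hi3 : Integrable
        (fun ω => 1 + l ^ 2 * t ^ 2 * (Real.exp (X ω ^ 2 / t ^ 2) - 1)) μ :=
      (integrable_const 1).add hi4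
    calc ∫ ω, Real.exp (l * X ω) ∂μ
        ≤ ∫ ω, (l * X ω + (1 + l ^ 2 * t ^ 2 * (Real.exp (X ω ^ 2 / t ^ 2) - 1))) ∂μ :=
          integral_mono hint ((hXi.const_mul l).add hi3)
            fun ω => exp_mul_le_of_sq_le_one _ ht hl
      _ = 1 + l ^ 2 * t ^ 2 * (∫ ω, Real.exp (X ω ^ 2 / t ^ 2) ∂μ - 1) := by
          rw [integral_add (hXi.const_mul l) hi3, integral_add (integrable_const 1) hi4,
            integral_const_mul, integral_const_mul, integral_sub hi (integrable_const 1), h0]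
          simp
      _ ≤ 1 + l ^ 2 * t ^ 2 * 1 := by gcongr; linarith
      _ ≤ Real.exp (l ^ 2 * t ^ 2) := by linarith [Real.add_one_le_exp (l ^ 2 * t ^ 2)]
  · calc ∫ ω, Real.exp (l * X ω) ∂μ
        ≤ ∫ ω, Real.exp (l ^ 2 * t ^ 2 / 2) * ((1 + Real.exp (X ω ^ 2 / t ^ 2)) / 2) ∂μ :=
          integral_mono hint hi2 fun ω => exp_mul_le_of_pos _ _ ht
      _ = Real.exp (l ^ 2 * t ^ 2 / 2) * ((1 + ∫ ω, Real.exp (X ω ^ 2 / t ^ 2) ∂μ) / 2) := by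
          rw [integral_const_mul, integral_div, integral_add (integrable_const 1) hi]
          simp
      _ ≤ Real.exp (l ^ 2 * t ^ 2 / 2) * Real.exp (l ^ 2 * t ^ 2 / 2) := by
          gcongr
          linarith [Real.add_one_le_exp (l ^ 2 * t ^ 2 / 2)]
      _ = Real.exp (l ^ 2 * t ^ 2) := by rw [← Real.exp_add]; congr 1; ring

theorem exists_lintegral_exp_sq_le {Ω : Type*} [MeasurableSpace Ω] {μ : Measure Ω}
    {X : Ω → ℝ} {σ : ℝ} (h : subGaussianNorm X μ = ENNReal.ofReal σ) {r : ℝ} (hr : σ < r)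
    (hr0 : 0 < r) :
    ∃ t, 0 < t ∧ t < r ∧ ∫⁻ ω, ENNReal.ofReal (Real.exp (X ω ^ 2 / t ^ 2)) ∂μ ≤ 2 := by
  have : subGaussianNorm X μ < ENNReal.ofReal r := by
    rw [h]; exact (ENNReal.ofReal_lt_ofReal_iff hr0).mpr hr
  simp only [subGaussianNorm, iInf_lt_iff] at this
  obtain ⟨t, ht, hle, htr⟩ := this
  exact ⟨t, ht, (ENNReal.ofReal_lt_ofReal_iff hr0).mp htr, hle⟩

theorem hasSubgaussianMGF_of_subGaussianNorm {Ω : Type*} [MeasurableSpace Ω] {μ : Measure Ω}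
    [IsProbabilityMeasure μ] {X : Ω → ℝ} (hX : Measurable X) (h0 : ∫ ω, X ω ∂μ = 0) {σ : ℝ}
    (hσ : 0 ≤ σ) (h : subGaussianNorm X μ = ENNReal.ofReal σ) :
    HasSubgaussianMGF X (Real.toNNReal (2 * σ ^ 2)) μ := by
  constructor
  · intro l
    obtain ⟨t, ht, -, hle⟩ := exists_lintegral_exp_sq_le h (lt_add_one σ) (by linarith)
    exact (mgf_le_of_lintegral_exp_sq_le hX h0 ht hle l).1
  · intro l
    rw [Real.coe_toNNReal _ (by positivity)]
    -- The infimum defining the norm need not be known to be attained, and `σ` may be `0`; so the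
    -- bound is proved for each `r > σ` and passed to the limit.
    have key : ∀ r > σ, mgf X μ l ≤ Real.exp (l ^ 2 * r ^ 2) := by
      intro r hr
      obtain ⟨t, ht, htr, hle⟩ := exists_lintegral_exp_sq_le h hr (by linarith)
      refine (mgf_le_of_lintegral_exp_sq_le hX h0 ht hle l).2.trans ?_
      gcongr
    have hc : Filter.Tendsto (fun r => Real.exp (l ^ 2 * r ^ 2)) (nhdsWithin σ (Set.Ioi σ))
        (nhds (Real.exp (l ^ 2 * σ ^ 2))) :=
      ((by fun_prop : Continuous fun r : ℝ => Real.exp (l ^ 2 * r ^ 2)).tendsto σ).mono_left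
        nhdsWithin_le_nhds
    refine (ge_of_tendsto hc (eventually_mem_nhdsWithin.mono key)).trans_eq ?_
    congr 1; ring

theorem measure_lt_sq_le {Ω : Type*} [MeasurableSpace Ω] {μ : Measure Ω}
    {X : Ω → ℝ} {κ : ℝ≥0} (hX : HasSubgaussianMGF X κ μ) [IsProbabilityMeasure μ]
    {L : ℝ} (hL : 0 ≤ L) :
    μ {ω | 2 * κ * L < X ω ^ 2} ≤ ENNReal.ofReal (2 * Real.exp (-L)) := by
  rcases eq_or_ne κ 0 with rfl | hκ
  · have h0 := hX.ae_eq_zero_of_hasSubgaussianMGF_zero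
    have : μ {ω | 2 * ((0 : ℝ≥0) : ℝ) * L < X ω ^ 2} = 0 := by
      refine measure_mono_null (fun ω hω => ?_) (ae_iff.mp h0)
      simp only [NNReal.coe_zero, mul_zero, zero_mul, Set.mem_ofPred_eq] at hω ⊢
      intro h
      rw [h] at hω
      simp at hω
    rw [this]
    exact zero_le
  · have hκ' : (0 : ℝ) < κ := by positivity
    set x := √(2 * κ * L) with hx
    have hx2 : x ^ 2 = 2 * κ * L := Real.sq_sqrt (by positivity)
    have hexp : Real.exp (-x ^ 2 / (2 * κ)) = Real.exp (-L) := by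
      rw [hx2]; congr 1; field_simp
    have h1 := hX.measure_ge_le (Real.sqrt_nonneg (2 * κ * L))
    have h2 := hX.neg.measure_ge_le (Real.sqrt_nonneg (2 * κ * L))
    rw [← hx, hexp] at h1 h2
    have hsub : {ω | 2 * κ * L < X ω ^ 2} ⊆ {ω | x ≤ X ω} ∪ {ω | x ≤ (-X) ω} := by
      intro ω hω
      have hω' : x ^ 2 < X ω ^ 2 := by rw [hx2]; exact hω
      have := sq_lt_sq.mp hω'
      exact le_abs.mp ((le_abs_self x).trans this.le)
    have h3 : μ.real {ω | 2 * κ * L < X ω ^ 2} ≤ 2 * Real.exp (-L) := by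
      refine (measureReal_mono hsub).trans ((measureReal_union_le _ _).trans ?_)
      linarith
    rw [← ofReal_measureReal]
    exact ENNReal.ofReal_le_ofReal h3

/-- The strict, self-normalized form stays meaningful when all coefficients vanish. This matters
later, when the coefficients are differences of estimators that may coincide. -/
theorem measure_lt_sq_sum_le {Ω ι : Type*} [Fintype ι] [MeasurableSpace Ω] {μ : Measure Ω}
    {X : ι → Ω → ℝ} (hind : iIndepFun X μ) {κ : ℝ≥0} (hX : ∀ i, HasSubgaussianMGF (X i) κ μ)
    (a : ι → ℝ) {L : ℝ} (hL : 0 ≤ L) :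
    μ {ω | 2 * κ * L * ∑ i, a i ^ 2 < (∑ i, a i * X i ω) ^ 2}
      ≤ ENNReal.ofReal (2 * Real.exp (-L)) := by
  have := hind.isProbabilityMeasure
  have hind' : iIndepFun (fun i ω => a i * X i ω) μ :=
    hind.comp (fun i x => a i * x) fun i => by fun_prop
  have hX' : ∀ i, HasSubgaussianMGF (fun ω => a i * X i ω) (Real.toNNReal (a i ^ 2) * κ) μ := by
    intro i
    rw [Real.toNNReal_of_nonneg (sq_nonneg (a i))]
    exact (hX i).const_mul (a i)
  have hs := HasSubgaussianMGF.sum_of_iIndepFun hind' (s := Finset.univ) fun i _ => hX' i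
  convert measure_lt_sq_le hs hL using 4
  rw [← Finset.sum_mul, NNReal.coe_mul, NNReal.coe_sum]
  simp only [Real.coe_toNNReal _ (sq_nonneg _)]
  ring_nf

/-- Replaces conditioning on `Z`: by independence the joint law is a product, and Fubini integrates
the bound over the slices. -/
theorem measure_prodMk_mem_le_of_indepFun {Ω α β : Type*} [MeasurableSpace Ω] [MeasurableSpace α]
    [MeasurableSpace β] {μ : Measure Ω} [IsProbabilityMeasure μ] {X : Ω → α} {Z : Ω → β}
    (hX : Measurable X) (hZ : Measurable Z) (h : IndepFun X Z μ) {B : Set (α × β)}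
    (hB : MeasurableSet B) {b : ℝ≥0∞} (hb : ∀ z, μ {ω | (X ω, z) ∈ B} ≤ b) :
    μ {ω | (X ω, Z ω) ∈ B} ≤ b := by
  have h1 := (indepFun_iff_map_prod_eq_prod_map_map hX.aemeasurable hZ.aemeasurable).mp h
  have : IsProbabilityMeasure (μ.map Z) := Measure.isProbabilityMeasure_map hZ.aemeasurable
  have : IsProbabilityMeasure (μ.map X) := Measure.isProbabilityMeasure_map hX.aemeasurable
  calc μ {ω | (X ω, Z ω) ∈ B} = (μ.map fun ω => (X ω, Z ω)) B :=
        (Measure.map_apply (hX.prodMk hZ) hB).symm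
    _ = ∫⁻ z, μ.map X ((fun x => (x, z)) ⁻¹' B) ∂(μ.map Z) := by
        rw [h1, Measure.prod_apply_symm hB]
    _ ≤ ∫⁻ _, b ∂(μ.map Z) := by
        refine lintegral_mono fun z => ?_
        rw [Measure.map_apply hX (measurable_prodMk_right hB)]
        exact hb z
    _ = b := by simp

/-! ### Singular value sums and operator norm bounds -/

/-- The construction of `exists_isSVD` takes square roots of the ordered eigenvalues of the Gram
operator, so its coefficients are the ordered singular values in which the final bound is expressed.
-/
theorem exists_isSVD_singularValue {n : ℕ} (y : Matrix (Fin n) (Fin n) ℝ) :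
    ∃ u v, IsSVD y (singularValue y) u v := by
  set T := Matrix.toEuclideanLin y with hTdef
  have hn : Module.finrank ℝ (EuclideanSpace ℝ (Fin n)) = n := by simp
  have hT := T.isSymmetric_adjoint_comp_self
  set v := hT.eigenvectorBasis hn with hv
  set s : Fin n → ℝ := fun i => √(hT.eigenvalues hn i) with hs
  have hs2 : ∀ i, s i * s i = hT.eigenvalues hn i := fun i =>
    Real.mul_self_sqrt (T.isPositive_adjoint_comp_self.nonneg_eigenvalues hn i)
  have hin : ∀ i j, inner ℝ (T (v i)) (T (v j)) = if i = j then s i * s i else 0 := by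
    intro i j
    rw [← LinearMap.adjoint_inner_right, ← LinearMap.comp_apply, hT.apply_eigenvectorBasis hn j,
      inner_smul_right, orthonormal_iff_ite.mp v.orthonormal i j]
    split_ifs with h
    · subst h; simp [hs2]
    · simp
  have hort : Orthonormal ℝ (Set.domRestrict {i | s i ≠ 0} fun i => (s i)⁻¹ • T (v i)) := by
    rw [orthonormal_iff_ite]
    rintro ⟨i, hi⟩ ⟨j, hj⟩
    have hi' : s i ≠ 0 := hi
    simp only [Set.domRestrict_apply, inner_smul_left, inner_smul_right, hin, Subtype.mk.injEq]
    split_ifs with h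
    · subst h; simp; field_simp
    · simp
  obtain ⟨u, hu⟩ := hort.exists_orthonormalBasis_extension_of_card_eq (by simp)
  have key : ∀ i, T (v i) = s i • u i := by
    intro i
    by_cases h : s i = 0
    · have : inner ℝ (T (v i)) (T (v i)) = 0 := by rw [hin]; simp [h]
      rw [inner_self_eq_zero.mp this, h, zero_smul]
    · rw [hu i h, smul_smul, mul_inv_cancel₀ h, one_smul]
  have hsv : singularValue y = s := by
    funext i
    exact T.singularValues_fin hn i
  refine ⟨u, v, fun i => by rw [hsv]; exact Real.sqrt_nonneg _, ?_⟩
  rw [hsv]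
  apply Matrix.toEuclideanLin.injective
  refine v.toBasis.ext fun j => ?_
  rw [OrthonormalBasis.coe_toBasis, toEuclideanLin_sum]
  simp [orthonormal_iff_ite.mp v.orthonormal, ← hTdef, key]

section Sums

variable {n : ℕ} (S : Finset (Fin n)) (s : Fin n → ℝ)
  (u v : OrthonormalBasis (Fin n) ℝ (EuclideanSpace ℝ (Fin n)))

theorem norm_sq_sum_smul (c : Fin n → ℝ) : ‖∑ i ∈ S, c i • u i‖ ^ 2 = ∑ i ∈ S, c i ^ 2 := by
  rw [← real_inner_self_eq_norm_sq, u.orthonormal.inner_sum]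
  exact Finset.sum_congr rfl fun i _ => by simp [sq]

theorem frobSq_sum_vecMulVec :
    frobSq (∑ i ∈ S, s i • Matrix.vecMulVec (u i).ofLp (v i).ofLp) = ∑ i ∈ S, s i ^ 2 := by
  have h1 : ∀ a, ∑ b, (∑ i ∈ S, s i • Matrix.vecMulVec (u i).ofLp (v i).ofLp) a b ^ 2
      = ∑ i ∈ S, s i ^ 2 * (u i).ofLp a ^ 2 := by
    intro a
    have h2 := norm_sq_sum_smul S v fun i => s i * (u i).ofLp a
    rw [EuclideanSpace.norm_sq_eq] at h2
    simp only [mul_pow] at h2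
    rw [← h2]
    refine Finset.sum_congr rfl fun b _ => ?_
    simp [Matrix.sum_apply, Matrix.vecMulVec_apply, mul_assoc]
  rw [frobSq, Finset.sum_congr rfl fun a _ => h1 a, Finset.sum_comm]
  refine Finset.sum_congr rfl fun i _ => ?_
  rw [← Finset.mul_sum]
  have h3 : ∑ a, (u i).ofLp a ^ 2 = 1 := by
    have := EuclideanSpace.norm_sq_eq (u i)
    rw [u.norm_eq_one] at this
    simpa using this.symm
  rw [h3, mul_one]

theorem norm_sq_toEuclideanLin_sum (x : EuclideanSpace ℝ (Fin n)) :
    ‖Matrix.toEuclideanLin (∑ i ∈ S, s i • Matrix.vecMulVec (u i).ofLp (v i).ofLp) x‖ ^ 2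
      = ∑ i ∈ S, s i ^ 2 * inner ℝ (v i) x ^ 2 := by
  rw [toEuclideanLin_sum, norm_sq_sum_smul]
  simp only [mul_pow]

theorem sum_inner_sq (x : EuclideanSpace ℝ (Fin n)) : ∑ i, inner ℝ (v i) x ^ 2 = ‖x‖ ^ 2 := by
  rw [← v.sum_sq_norm_inner_right x]
  simp

end Sums

/-- The operator norm of `A` is at most `B`. -/
def OpBound {n : ℕ} (A : Matrix (Fin n) (Fin n) ℝ) (B : ℝ) : Prop :=
  ∀ x : EuclideanSpace ℝ (Fin n), ‖Matrix.toEuclideanLin A x‖ ≤ B * ‖x‖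

namespace OpBound

variable {n : ℕ} {A A' : Matrix (Fin n) (Fin n) ℝ} {B B' : ℝ}

theorem mono (h : OpBound A B) (hB : B ≤ B') : OpBound A B' := fun x =>
  (h x).trans (by gcongr)

theorem add (h : OpBound A B) (h' : OpBound A' B') : OpBound (A + A') (B + B') := fun x => by
  rw [map_add, LinearMap.add_apply, add_mul]
  exact (norm_add_le _ _).trans (add_le_add (h x) (h' x))

theorem smul (h : OpBound A B) {r : ℝ} (hr : 0 ≤ r) : OpBound (r • A) (r * B) := fun x => by
  rw [map_smul, LinearMap.smul_apply, norm_smul, Real.norm_of_nonneg hr, mul_assoc]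
  exact mul_le_mul_of_nonneg_left (h x) hr

theorem neg (h : OpBound A B) : OpBound (-A) B := fun x => by
  rw [map_neg, LinearMap.neg_apply, norm_neg]
  exact h x

theorem sub (h : OpBound A B) (h' : OpBound A' B') : OpBound (A - A') (B + B') := by
  rw [sub_eq_add_neg]; exact h.add h'.neg

theorem sum_vecMulVec (S : Finset (Fin n)) (s : Fin n → ℝ)
    (u v : OrthonormalBasis (Fin n) ℝ (EuclideanSpace ℝ (Fin n))) (hB : 0 ≤ B)
    (hs : ∀ i ∈ S, |s i| ≤ B) :
    OpBound (∑ i ∈ S, s i • Matrix.vecMulVec (u i).ofLp (v i).ofLp) B := fun x => by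
  refine le_of_sq_le_sq ?_ (by positivity)
  rw [norm_sq_toEuclideanLin_sum, mul_pow, ← sum_inner_sq v x, Finset.mul_sum]
  refine (Finset.sum_le_sum fun i hi => ?_).trans
    (Finset.sum_le_univ_sum_of_nonneg fun i => by positivity)
  have := sq_le_sq' (by linarith [neg_abs_le (s i), hs i hi]) ((le_abs_self (s i)).trans (hs i hi))
  gcongr

end OpBound

/-! ### Deterministic error of singular value thresholding -/

section Threshold

variable {n : ℕ}

/-- The rank is at most `T.card` and every singular value is at most `B`. -/
theorem frobSq_le_card_mul {A : Matrix (Fin n) (Fin n) ℝ} {B : ℝ} (hB : OpBound A B)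
    (T : Finset (EuclideanSpace ℝ (Fin n)))
    (hT : ∀ x, Matrix.toEuclideanLin A x ∈ Submodule.span ℝ (T : Set (EuclideanSpace ℝ (Fin n)))) :
    frobSq A ≤ T.card * B ^ 2 := by
  obtain ⟨s, u, v, h⟩ := exists_isSVD A
  have hv : ∀ i, Matrix.toEuclideanLin A (v i) = s i • u i := by
    intro i
    rw [h.eq_sum, toEuclideanLin_sum]
    simp [orthonormal_iff_ite.mp v.orthonormal]
  have hs : ∀ i, s i ≤ B := by
    intro i
    have := hB (v i)
    rwa [hv, norm_smul, u.norm_eq_one, v.norm_eq_one, mul_one, mul_one,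
      Real.norm_of_nonneg (h.nonneg i)] at this
  have hcard : (Finset.univ.filter fun i => s i ≠ 0).card ≤ T.card := by
    refine le_trans ?_ (finrank_span_finset_le_card (R := ℝ) T)
    rw [← Fintype.card_coe]
    let w : {i // i ∈ Finset.univ.filter fun i => s i ≠ 0} →
        Submodule.span ℝ (T : Set (EuclideanSpace ℝ (Fin n))) := fun i => ⟨u i, by
      have hi : s i ≠ 0 := (Finset.mem_filter.mp i.2).2
      have h1 := Submodule.smul_mem _ (s i)⁻¹ (hT (v i))
      rwa [hv, smul_smul, inv_mul_cancel₀ hi, one_smul] at h1⟩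
    have hw : LinearIndependent ℝ w := by
      refine LinearIndependent.of_comp (Submodule.subtype _) ?_
      exact u.orthonormal.linearIndependent.comp _ Subtype.val_injective
    exact hw.fintype_card_le_finrank
  calc frobSq A = ∑ i, s i ^ 2 := by
        conv_lhs => rw [h.eq_sum]
        exact frobSq_sum_vecMulVec _ s u v
    _ = ∑ i with s i ≠ 0, s i ^ 2 := by
        rw [Finset.sum_filter]
        refine Finset.sum_congr rfl fun i _ => ?_
        by_cases hi : s i = 0 <;> simp [hi]
    _ ≤ (Finset.univ.filter fun i => s i ≠ 0).card • B ^ 2 :=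
        Finset.sum_le_card_nsmul _ _ _ fun i _ => by
          have := h.nonneg i
          gcongr
          exact hs i
    _ ≤ T.card * B ^ 2 := by
        rw [nsmul_eq_mul]
        gcongr

/-- A dimension count in the spirit of Weyl's inequality. Otherwise some nonzero `x` in the span of
the leading `v i` is orthogonal to all the leading `v' j`; then `‖y x‖ > t ‖x‖`, while `‖θ x‖` and
`‖(y - θ) x‖` are each at most `t / 2 * ‖x‖`. -/
theorem card_lt_le_card_half_lt {y θ : Matrix (Fin n) (Fin n) ℝ} {s r : Fin n → ℝ}
    {u v u' v' : OrthonormalBasis (Fin n) ℝ (EuclideanSpace ℝ (Fin n))}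
    (hy : IsSVD y s u v) (hθ : IsSVD θ r u' v') {t : ℝ} (ht : 0 < t)
    (hE : OpBound (y - θ) (t / 2)) :
    (Finset.univ.filter fun i => t < s i).card ≤ (Finset.univ.filter fun i => t / 2 < r i).card := by
  by_contra! hlt
  set S := Finset.univ.filter fun i => t < s i with hS
  set R := Finset.univ.filter fun i => t / 2 < r i with hR
  let Φ : (S → ℝ) →ₗ[ℝ] (R → ℝ) :=
    LinearMap.pi (fun j => (innerₛₗ ℝ (v' j)) ∘ₗ Fintype.linearCombination ℝ fun i : S => v i)
  have hker : LinearMap.ker Φ ≠ ⊥ := LinearMap.ker_ne_bot_of_finrank_lt (by simpa using hlt)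
  obtain ⟨c, hc, hc0⟩ := Submodule.exists_mem_ne_zero_of_ne_bot hker
  have hcΦ : Φ c = 0 := hc
  let c' : Fin n → ℝ := fun i => if h : i ∈ S then c ⟨i, h⟩ else 0
  set x : EuclideanSpace ℝ (Fin n) := ∑ i ∈ S, c' i • v i with hx
  have hxc : x = Fintype.linearCombination ℝ (fun i : S => v i) c := by
    rw [hx, Fintype.linearCombination_apply, ← Finset.sum_coe_sort]
    refine Finset.sum_congr rfl fun i _ => ?_
    simp [c']
  have hxR : ∀ j ∈ R, inner ℝ (v' j) x = 0 := by
    intro j hj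
    have := congrFun hcΦ ⟨j, hj⟩
    rw [hxc]
    simpa [Φ] using this
  have hxS : ∀ i, inner ℝ (v i) x = if i ∈ S then c' i else 0 := by
    intro i
    simp only [hx, inner_sum, inner_smul_right, orthonormal_iff_ite.mp v.orthonormal]
    simp
  have hc'0 : ∃ i ∈ S, c' i ≠ 0 := by
    by_contra! h0
    refine hc0 (funext fun i => ?_)
    have := h0 i i.2
    simpa [c'] using this
  have hnx : ‖x‖ ^ 2 = ∑ i ∈ S, c' i ^ 2 := norm_sq_sum_smul S v c'
  have h1 : t ^ 2 * ‖x‖ ^ 2 < ‖Matrix.toEuclideanLin y x‖ ^ 2 := by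
    rw [hy.eq_sum, norm_sq_toEuclideanLin_sum, hnx, Finset.mul_sum]
    simp only [hxS, ite_pow, mul_ite]
    simp only [ne_eq, OfNat.ofNat_ne_zero, not_false_eq_true, zero_pow, mul_zero,
      Finset.sum_ite_mem, Finset.univ_inter]
    obtain ⟨i, hi, hi0⟩ := hc'0
    have hpos : ∀ i ∈ S, t ^ 2 < s i ^ 2 := fun i hi =>
      pow_lt_pow_left₀ (Finset.mem_filter.mp hi).2 ht.le two_ne_zero
    refine Finset.sum_lt_sum (fun i hi => ?_) ⟨i, hi, ?_⟩
    · have := (hpos i hi).le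
      gcongr
    · have := hpos i hi
      have h2 : 0 < c' i ^ 2 := by positivity
      exact mul_lt_mul_of_pos_right this h2
  have h2 : ‖Matrix.toEuclideanLin θ x‖ ^ 2 ≤ (t / 2 * ‖x‖) ^ 2 := by
    rw [hθ.eq_sum, norm_sq_toEuclideanLin_sum, mul_pow, ← sum_inner_sq v' x, Finset.mul_sum]
    refine Finset.sum_le_sum fun j _ => ?_
    by_cases hj : j ∈ R
    · simp [hxR j hj]
    · have h3 : r j ≤ t / 2 := by simpa [hR] using hj
      have h4 := hθ.nonneg j
      gcongr
  have h2' := (sq_le_sq₀ (norm_nonneg _) (by positivity)).mp h2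
  have h3 : ‖Matrix.toEuclideanLin y x‖ ≤ t * ‖x‖ := by
    have h4 := hE x
    rw [map_sub, LinearMap.sub_apply] at h4
    have h5 := norm_sub_norm_le (Matrix.toEuclideanLin y x) (Matrix.toEuclideanLin θ x)
    linarith
  have h4 : ‖Matrix.toEuclideanLin y x‖ ^ 2 ≤ (t * ‖x‖) ^ 2 := by gcongr
  rw [mul_pow] at h4
  linarith

theorem frobSq_add_le (A B : Matrix (Fin n) (Fin n) ℝ) :
    frobSq (A + B) ≤ 2 * frobSq A + 2 * frobSq B := by
  simp only [frobSq, Finset.mul_sum, ← Finset.sum_add_distrib, Matrix.add_apply]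
  refine Finset.sum_le_sum fun i _ => Finset.sum_le_sum fun j _ => ?_
  nlinarith [sq_nonneg (A i j - B i j)]

/-- With `θk` the part of `θ` above level `t / 2`, the difference `svt t y - θk` has rank at most `2
* R.card` and operator norm at most `2 * t`, so its squared Frobenius norm is at most `8 * R.card *
t ^ 2`. Each `j ∈ R` contributes at least `t ^ 2 / 4` to the target sum, whence the factor 64 after
doubling. The remainder of `θ` has singular values at most `t / 2`, for which the minimum is `r j ^
2`. -/
theorem frobSq_svt_sub_le {y θ : Matrix (Fin n) (Fin n) ℝ} {t : ℝ} (ht : 0 < t)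
    (hE : OpBound (y - θ) (t / 2)) :
    frobSq (svt t y - θ) ≤ 64 * ∑ j, min (t ^ 2) (singularValue θ j ^ 2) := by
  classical
  obtain ⟨s, u, v, hy⟩ := exists_isSVD y
  obtain ⟨u', v', hθ⟩ := exists_isSVD_singularValue θ
  set r := singularValue θ with hr
  have hcard := card_lt_le_card_half_lt hy hθ ht hE
  set S := Finset.univ.filter fun i => t < s i with hS
  set R := Finset.univ.filter fun i => t / 2 < r i with hR
  have hsvt : svt t y = ∑ i ∈ S, s i • Matrix.vecMulVec (u i).ofLp (v i).ofLp := by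
    rw [svt_eq_truncatedSum t hy, truncatedSum]
    refine Finset.sum_congr ?_ fun _ _ => rfl
    rw [hS]
    exact Finset.filter_congr fun i _ => by rw [abs_of_nonneg (hy.nonneg i)]
  set θk := ∑ j ∈ R, r j • Matrix.vecMulVec (u' j).ofLp (v' j).ofLp with hθk
  have hy_sub : y - svt t y = ∑ i ∈ Sᶜ, s i • Matrix.vecMulVec (u i).ofLp (v i).ofLp := by
    rw [hsvt, sub_eq_iff_eq_add, Finset.sum_compl_add_sum]
    exact hy.eq_sum
  have hθ_sub : θ - θk = ∑ j ∈ Rᶜ, r j • Matrix.vecMulVec (u' j).ofLp (v' j).ofLp := by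
    rw [hθk, sub_eq_iff_eq_add, Finset.sum_compl_add_sum]
    exact hθ.eq_sum
  have b1 : OpBound (y - svt t y) t := by
    rw [hy_sub]
    refine OpBound.sum_vecMulVec _ _ _ _ ht.le fun i hi => ?_
    rw [abs_of_nonneg (hy.nonneg i)]
    simpa [hS] using hi
  have b2 : OpBound (θ - θk) (t / 2) := by
    rw [hθ_sub]
    refine OpBound.sum_vecMulVec _ _ _ _ (by positivity) fun i hi => ?_
    rw [abs_of_nonneg (hθ.nonneg i)]
    simpa [hR] using hi
  have b3 : OpBound (svt t y - θk) (2 * t) := by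
    have := (hE.add b2).sub b1
    convert this using 1
    · abel
    · ring
  have f1 : frobSq (svt t y - θk) ≤ 2 * R.card * (2 * t) ^ 2 := by
    -- The range of the difference lies in the span of the left singular vectors of both
    -- truncations.
    have h1 := frobSq_le_card_mul b3 (S.image u ∪ R.image u') fun x => by
      rw [map_sub, LinearMap.sub_apply, hsvt, hθk, toEuclideanLin_sum, toEuclideanLin_sum]
      refine Submodule.sub_mem _ ?_ ?_
      · refine Submodule.sum_mem _ fun i hi => Submodule.smul_mem _ _ (Submodule.subset_span ?_)
        exact Finset.mem_coe.mpr (Finset.mem_union_left _ (Finset.mem_image_of_mem _ hi))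
      · refine Submodule.sum_mem _ fun i hi => Submodule.smul_mem _ _ (Submodule.subset_span ?_)
        exact Finset.mem_coe.mpr (Finset.mem_union_right _ (Finset.mem_image_of_mem _ hi))
    refine h1.trans ?_
    have h2 : (S.image u ∪ R.image u').card ≤ 2 * R.card := by
      have := Finset.card_union_le (S.image u) (R.image u')
      have h3 : (S.image u).card ≤ S.card := Finset.card_image_le
      have h4 : (R.image u').card ≤ R.card := Finset.card_image_le
      omega
    have h3 : ((S.image u ∪ R.image u').card : ℝ) ≤ 2 * R.card := by exact_mod_cast h2
    gcongr
  have f2 : frobSq (θk - θ) = ∑ j ∈ Rᶜ, r j ^ 2 := by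
    have : frobSq (θk - θ) = frobSq (θ - θk) := by
      simp only [frobSq, Matrix.sub_apply]
      refine Finset.sum_congr rfl fun i _ => Finset.sum_congr rfl fun j _ => ?_
      ring
    rw [this, hθ_sub, frobSq_sum_vecMulVec]
  have f3 := frobSq_add_le (svt t y - θk) (θk - θ)
  rw [sub_add_sub_cancel] at f3
  have g1 : (R.card : ℝ) * (t ^ 2 / 4) ≤ ∑ j ∈ R, min (t ^ 2) (r j ^ 2) := by
    rw [← nsmul_eq_mul]
    refine Finset.card_nsmul_le_sum _ _ _ fun j hj => ?_
    have h1 : t / 2 < r j := (Finset.mem_filter.mp hj).2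
    refine le_min (by nlinarith) (by nlinarith)
  have g2 : ∑ j ∈ Rᶜ, r j ^ 2 ≤ ∑ j ∈ Rᶜ, min (t ^ 2) (r j ^ 2) := by
    refine Finset.sum_le_sum fun j hj => ?_
    have h1 : r j ≤ t / 2 := by simpa [hR] using hj
    have h2 := hθ.nonneg j
    refine le_min (by nlinarith) le_rfl
  rw [← Finset.sum_add_sum_compl R]
  have g3 : 0 ≤ ∑ j ∈ Rᶜ, r j ^ 2 := Finset.sum_nonneg fun _ _ => sq_nonneg _
  linarith

end Threshold

/-! ### Nets of the unit ball and bilinear forms -/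

section Net

/-- A `1 / 2`-separated subset of the ball of maximal cardinality is a net. Doubling it gives a
1-separated set in the ball of radius 2, to which the volume bound `5 ^ n` applies. -/
theorem exists_half_net (n : ℕ) : ∃ T : Finset (EuclideanSpace ℝ (Fin n)),
    T.card ≤ 5 ^ n ∧ (∀ x ∈ T, ‖x‖ ≤ 1) ∧
      ∀ x : EuclideanSpace ℝ (Fin n), ‖x‖ ≤ 1 → ∃ s ∈ T, ‖x - s‖ ≤ 1 / 2 := by
  classical
  let P : Finset (EuclideanSpace ℝ (Fin n)) → Prop := fun T =>
    (∀ x ∈ T, ‖x‖ ≤ 1) ∧ ∀ x ∈ T, ∀ y ∈ T, x ≠ y → 1 / 2 ≤ ‖x - y‖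
  have hcard : ∀ T, P T → T.card ≤ 5 ^ n := by
    intro T hT
    have hinj : Function.Injective fun x : EuclideanSpace ℝ (Fin n) => (2 : ℝ) • x :=
      smul_right_injective _ two_ne_zero
    have := Besicovitch.card_le_of_separated (T.image fun x => (2 : ℝ) • x) ?_ ?_
    · rwa [Finset.card_image_of_injective _ hinj, finrank_euclideanSpace_fin] at this
    · intro c hc
      obtain ⟨x, hx, rfl⟩ := Finset.mem_image.mp hc
      rw [norm_smul, Real.norm_two]
      linarith [hT.1 x hx]
    · intro c hc d hd hcd
      obtain ⟨x, hx, rfl⟩ := Finset.mem_image.mp hc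
      obtain ⟨y, hy, rfl⟩ := Finset.mem_image.mp hd
      rw [← smul_sub, norm_smul, Real.norm_two]
      linarith [hT.2 x hx y hy fun h => hcd (by rw [h])]
  obtain ⟨T, hT, hTk⟩ := Nat.findGreatest_spec (P := fun k => ∃ T, P T ∧ T.card = k) (n := 5 ^ n)
    (Nat.zero_le _) ⟨∅, by simp [P], rfl⟩
  refine ⟨T, hcard T hT, hT.1, fun x hx => ?_⟩
  by_contra! hfar
  have hxT : x ∉ T := fun h => by
    have := hfar x h
    simp at this
    linarith
  have hP : P (insert x T) := by
    refine ⟨?_, ?_⟩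
    · intro z hz
      rcases Finset.mem_insert.mp hz with rfl | hz
      · exact hx
      · exact hT.1 z hz
    · intro z hz w hw hzw
      rcases Finset.mem_insert.mp hz with hz' | hz' <;> rcases Finset.mem_insert.mp hw with hw' | hw'
      · exact absurd (hz'.trans hw'.symm) hzw
      · rw [hz']; exact (hfar w hw').le
      · rw [hw', norm_sub_rev]; exact (hfar z hz').le
      · exact hT.2 z hz' w hw' hzw
  have h1 := Nat.le_findGreatest (P := fun k => ∃ T, P T ∧ T.card = k) (hcard _ hP) ⟨_, hP, rfl⟩
  rw [Finset.card_insert_of_notMem hxT] at h1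
  omega

theorem norm_le_two_mul_of_net {n : ℕ} {T : Finset (EuclideanSpace ℝ (Fin n))}
    (hT : ∀ x : EuclideanSpace ℝ (Fin n), ‖x‖ ≤ 1 → ∃ s ∈ T, ‖x - s‖ ≤ 1 / 2)
    {y : EuclideanSpace ℝ (Fin n)} {B : ℝ} (h : ∀ s ∈ T, inner ℝ s y ≤ B) : ‖y‖ ≤ 2 * B := by
  rcases eq_or_ne y 0 with rfl | hy
  · obtain ⟨s, hs, -⟩ := hT 0 (by simp)
    have := h s hs
    simp at this
    simpa using this
  · have hy' : 0 < ‖y‖ := norm_pos_iff.mpr hy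
    obtain ⟨s, hs, hxs⟩ := hT (‖y‖⁻¹ • y) (by rw [norm_smul, norm_inv, norm_norm]; field_simp; rfl)
    have h1 : inner ℝ (‖y‖⁻¹ • y) y = ‖y‖ := by
      rw [real_inner_smul_left, real_inner_self_eq_norm_sq]; field_simp
    have h2 : inner ℝ (‖y‖⁻¹ • y - s) y ≤ 1 / 2 * ‖y‖ :=
      (real_inner_le_norm _ _).trans (by gcongr)
    rw [inner_sub_left, h1] at h2
    linarith [h s hs]

/-- Each of the two arguments of the bilinear form costs a factor 2 when it is moved to the net. -/
theorem opBound_of_net {n : ℕ} {T : Finset (EuclideanSpace ℝ (Fin n))}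
    (hT : ∀ x : EuclideanSpace ℝ (Fin n), ‖x‖ ≤ 1 → ∃ s ∈ T, ‖x - s‖ ≤ 1 / 2)
    {A : Matrix (Fin n) (Fin n) ℝ} {B : ℝ}
    (h : ∀ a ∈ T, ∀ b ∈ T, inner ℝ a (Matrix.toEuclideanLin A b) ≤ B) : OpBound A (4 * B) := by
  have h1 : ∀ b ∈ T, ‖Matrix.toEuclideanLin A b‖ ≤ 2 * B := fun b hb =>
    norm_le_two_mul_of_net hT fun a ha => h a ha b hb
  set F := LinearMap.toContinuousLinearMap (Matrix.toEuclideanLin A) with hF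
  have hFA : ∀ x, F x = Matrix.toEuclideanLin A x := fun x => rfl
  obtain ⟨b0, hb0, -⟩ := hT 0 (by simp)
  have hB : 0 ≤ B := by linarith [(norm_nonneg _).trans (h1 b0 hb0)]
  have h2 : ‖F‖ ≤ 2 * B + 1 / 2 * ‖F‖ := by
    refine F.opNorm_le_of_unit_norm (by positivity) fun x hx => ?_
    obtain ⟨s, hs, hxs⟩ := hT x hx.le
    calc ‖F x‖ = ‖F s + F (x - s)‖ := by rw [← map_add, add_sub_cancel]
      _ ≤ ‖F s‖ + ‖F (x - s)‖ := norm_add_le _ _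
      _ ≤ 2 * B + ‖F‖ * (1 / 2) := add_le_add (h1 s hs) ((F.le_opNorm _).trans (by gcongr))
      _ = _ := by ring
  intro x
  rw [← hFA]
  refine (F.le_opNorm x).trans ?_
  gcongr
  linarith

theorem inner_toEuclideanLin_eq_sum {n : ℕ} (A : Matrix (Fin n) (Fin n) ℝ)
    (a b : EuclideanSpace ℝ (Fin n)) :
    inner ℝ a (Matrix.toEuclideanLin A b)
      = ∑ p : Fin n × Fin n, (a.ofLp p.1 * b.ofLp p.2) * A p.1 p.2 := by
  rw [Fintype.sum_prod_type]
  simp only [PiLp.inner_apply, Matrix.toLpLin_apply, Matrix.mulVec, dotProduct]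
  refine Finset.sum_congr rfl fun i _ => ?_
  simp only [RCLike.inner_apply, conj_trivial, Finset.sum_mul]
  exact Finset.sum_congr rfl fun j _ => by ring

theorem sum_mul_sq_le_one {n : ℕ} {a b : EuclideanSpace ℝ (Fin n)} (ha : ‖a‖ ≤ 1) (hb : ‖b‖ ≤ 1) :
    ∑ p : Fin n × Fin n, (a.ofLp p.1 * b.ofLp p.2) ^ 2 ≤ 1 := by
  have h1 : ∑ p : Fin n × Fin n, (a.ofLp p.1 * b.ofLp p.2) ^ 2 = ‖a‖ ^ 2 * ‖b‖ ^ 2 := by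
    rw [EuclideanSpace.norm_sq_eq, EuclideanSpace.norm_sq_eq, Finset.sum_mul_sum,
      Fintype.sum_prod_type]
    simp [mul_pow]
  rw [h1, ← mul_pow]
  exact pow_le_one₀ (by positivity) (mul_le_one₀ ha (norm_nonneg _) hb)

end Net

/-! ### Measurability of singular value thresholding -/

section Measurability

open Filter Topology

variable {n : ℕ}

/-- The matrix `∑ i, f i • u i (v i)ᵀ`. -/
noncomputable def spectralSum (f : Fin n → ℝ)
    (u v : OrthonormalBasis (Fin n) ℝ (EuclideanSpace ℝ (Fin n))) : Matrix (Fin n) (Fin n) ℝ :=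
  ∑ i, f i • Matrix.vecMulVec (u i).ofLp (v i).ofLp

variable (f g : Fin n → ℝ) (u v w : OrthonormalBasis (Fin n) ℝ (EuclideanSpace ℝ (Fin n)))

theorem spectralSum_mul : spectralSum f u v * spectralSum g v w = spectralSum (f * g) u w := by
  have hv : ∀ i j, (v i).ofLp ⬝ᵥ (v j).ofLp = if j = i then 1 else 0 := by
    intro i j
    rw [← orthonormal_iff_ite.mp v.orthonormal j i]
    simp [PiLp.inner_apply, dotProduct]
  simp only [spectralSum, Finset.sum_mul, Finset.mul_sum, Matrix.smul_mul, Matrix.mul_smul,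
    Matrix.vecMulVec_mul_vecMulVec, hv, Pi.mul_apply]
  refine Finset.sum_congr rfl fun i _ => ?_
  simp [ite_smul, apply_ite, smul_smul, mul_comm]

theorem transpose_spectralSum : (spectralSum f u v).transpose = spectralSum f v u := by
  simp [spectralSum, Matrix.transpose_sum, Matrix.transpose_vecMulVec]

theorem spectralSum_one : spectralSum 1 v v = 1 := by
  apply Matrix.toEuclideanLin.injective
  refine v.toBasis.ext fun j => ?_
  rw [spectralSum, OrthonormalBasis.coe_toBasis, toEuclideanLin_sum]
  simp [orthonormal_iff_ite.mp v.orthonormal]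

theorem spectralSum_add : spectralSum f u v + spectralSum g u v = spectralSum (f + g) u v := by
  simp [spectralSum, add_smul, Finset.sum_add_distrib]

theorem smul_spectralSum (r : ℝ) : r • spectralSum f u v = spectralSum (r • f) u v := by
  simp [spectralSum, Finset.smul_sum, smul_smul]

theorem spectralSum_pow (k : ℕ) : spectralSum f v v ^ k = spectralSum (f ^ k) v v := by
  induction k with
  | zero => rw [pow_zero, pow_zero, spectralSum_one]
  | succ k ih => rw [pow_succ, ih, spectralSum_mul, pow_succ]

theorem inv_spectralSum (hf : ∀ i, f i ≠ 0) :
    IsUnit (spectralSum f v v).det ∧ (spectralSum f v v)⁻¹ = spectralSum f⁻¹ v v := by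
  have h : spectralSum f v v * spectralSum f⁻¹ v v = 1 := by
    rw [spectralSum_mul, ← spectralSum_one v]
    congr 1
    funext i
    simp [hf i]
  exact ⟨Matrix.isUnit_det_of_right_inverse h, Matrix.inv_eq_right_inv h⟩

/-- The power `(yᵀ y / τ) ^ k`. -/
noncomputable def gramPow (τ : ℝ) (k : ℕ) (y : Matrix (Fin n) (Fin n) ℝ) :
    Matrix (Fin n) (Fin n) ℝ :=
  (τ⁻¹ • (y.transpose * y)) ^ k

/-- A continuous approximation of singular value thresholding at level `√τ`. -/
noncomputable def smoothSvt (τ : ℝ) (k : ℕ) (y : Matrix (Fin n) (Fin n) ℝ) :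
    Matrix (Fin n) (Fin n) ℝ :=
  y * ((1 + gramPow τ k y)⁻¹ * gramPow τ k y)

variable {f u v} {y : Matrix (Fin n) (Fin n) ℝ} {s : Fin n → ℝ}

theorem one_add_gramPow_eq (h : IsSVD y s u v) (τ : ℝ) (k : ℕ) :
    gramPow τ k y = spectralSum ((τ⁻¹ • (s * s)) ^ k) v v ∧
      1 + gramPow τ k y = spectralSum (1 + (τ⁻¹ • (s * s)) ^ k) v v := by
  have hy : y = spectralSum s u v := h.eq_sum
  have h1 : gramPow τ k y = spectralSum ((τ⁻¹ • (s * s)) ^ k) v v := by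
    rw [gramPow, hy, transpose_spectralSum, spectralSum_mul, smul_spectralSum, spectralSum_pow]
  refine ⟨h1, ?_⟩
  rw [h1, ← spectralSum_one v, spectralSum_add]

theorem one_add_pow_ne_zero (s : Fin n → ℝ) {τ : ℝ} (hτ : 0 < τ) (k : ℕ) (i : Fin n) :
    (1 + (τ⁻¹ • (s * s)) ^ k) i ≠ 0 := by
  have : 0 ≤ τ⁻¹ * (s i * s i) := mul_nonneg (by positivity) (mul_self_nonneg _)
  simp only [Pi.add_apply, Pi.one_apply, Pi.pow_apply, Pi.smul_apply, Pi.mul_apply, smul_eq_mul]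
  positivity

/-- The matrix formula acts on singular values as multiplication by a smooth step, while being
visibly continuous in `y`; no measurable choice of singular vectors is needed. -/
theorem smoothSvt_eq (h : IsSVD y s u v) {τ : ℝ} (hτ : 0 < τ) (k : ℕ) :
    smoothSvt τ k y = spectralSum
      (fun i => s i * ((τ⁻¹ * (s i * s i)) ^ k / (1 + (τ⁻¹ * (s i * s i)) ^ k))) u v := by
  obtain ⟨h1, h2⟩ := one_add_gramPow_eq h τ k
  have h3 := (inv_spectralSum _ v (one_add_pow_ne_zero s hτ k)).2
  have hy : y = spectralSum s u v := h.eq_sum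
  rw [smoothSvt, h2, h1, h3, spectralSum_mul]
  conv_lhs => rw [hy]
  rw [spectralSum_mul]
  congr 1
  funext i
  simp [div_eq_inv_mul]

theorem continuous_smoothSvt {τ : ℝ} (hτ : 0 < τ) (k : ℕ) :
    Continuous (smoothSvt τ k : Matrix (Fin n) (Fin n) ℝ → Matrix (Fin n) (Fin n) ℝ) := by
  have hg : Continuous (gramPow τ k : Matrix (Fin n) (Fin n) ℝ → Matrix (Fin n) (Fin n) ℝ) := by
    unfold gramPow
    fun_prop
  refine continuous_id.mul (Continuous.mul ?_ hg)
  rw [continuous_iff_continuousAt]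
  intro y
  obtain ⟨s, u, v, h⟩ := exists_isSVD y
  have h1 : ContinuousAt Inv.inv (1 + gramPow τ k y) := by
    refine continuousAt_matrix_inv _ ?_
    rw [(one_add_gramPow_eq h τ k).2]
    have := (inv_spectralSum _ v (one_add_pow_ne_zero s hτ k)).1
    rw [Ring.inverse_eq_inv']
    exact continuousAt_inv₀ this.ne_zero
  exact ContinuousAt.comp (f := fun y => 1 + gramPow τ k y) h1
    (continuous_const.add hg).continuousAt

open Classical in
/-- The pointwise limit of `x ↦ (x / τ) ^ k / (1 + (x / τ) ^ k)` as `k → ∞`. -/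
noncomputable def halfStep (τ x : ℝ) : ℝ := if τ < x then 1 else if x = τ then 1 / 2 else 0

theorem tendsto_halfStep {τ x : ℝ} (hτ : 0 < τ) (hx : 0 ≤ x) :
    Tendsto (fun k : ℕ => (τ⁻¹ * x) ^ k / (1 + (τ⁻¹ * x) ^ k)) atTop (𝓝 (halfStep τ x)) := by
  unfold halfStep
  have hq : 0 ≤ τ⁻¹ * x := by positivity
  split_ifs with h1 h2
  · have h3 : 1 < τ⁻¹ * x := by rw [← div_eq_inv_mul, one_lt_div hτ]; exact h1
    have h4 : Tendsto (fun k : ℕ => ((τ⁻¹ * x) ^ k)⁻¹) atTop (𝓝 0) :=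
      tendsto_inv_atTop_zero.comp (tendsto_pow_atTop_atTop_of_one_lt h3)
    have h5 : Tendsto (fun k : ℕ => (((τ⁻¹ * x) ^ k)⁻¹ + 1)⁻¹) atTop (𝓝 (0 + 1)⁻¹) :=
      (h4.add_const 1).inv₀ (by norm_num)
    rw [zero_add, inv_one] at h5
    refine h5.congr fun k => ?_
    have : (0 : ℝ) < (τ⁻¹ * x) ^ k := by positivity
    generalize (τ⁻¹ * x) ^ k = q at this
    field_simp
  · rw [h2, inv_mul_cancel₀ hτ.ne']
    norm_num
  · have h3 : τ⁻¹ * x < 1 := by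
      rw [← div_eq_inv_mul, div_lt_one hτ]
      exact lt_of_le_of_ne (not_lt.mp h1) h2
    have h4 := tendsto_pow_atTop_nhds_zero_of_lt_one hq h3
    have h5 := h4.div (h4.const_add 1) (by norm_num)
    rw [add_zero, zero_div] at h5
    exact h5

theorem tendsto_spectralSum_apply {F : ℕ → Fin n → ℝ} {f : Fin n → ℝ}
    (h : ∀ i, Tendsto (fun k => F k i) atTop (𝓝 (f i))) (a b : Fin n) :
    Tendsto (fun k => spectralSum (F k) u v a b) atTop (𝓝 (spectralSum f u v a b)) := by
  simp only [spectralSum, Matrix.sum_apply, Matrix.smul_apply]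
  exact tendsto_finsetSum _ fun i _ => (h i).smul_const _

theorem svt_eq_spectralSum (h : IsSVD y s u v) (t : ℝ) :
    svt t y = spectralSum (fun i => s i * if t < s i then 1 else 0) u v := by
  rw [svt_eq_truncatedSum t h, truncatedSum, spectralSum, Finset.sum_filter]
  refine Finset.sum_congr rfl fun i _ => ?_
  rw [abs_of_nonneg (h.nonneg i)]
  split_ifs <;> simp

/-- Approaching the threshold from strictly above removes the value `1 / 2` at the jump and yields
the strict indicator of `t < x`. -/
theorem tendsto_halfStep_sq {t x : ℝ} (ht : 0 < t) (hx : 0 ≤ x) :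
    Tendsto (fun k : ℕ => halfStep ((t + 1 / ((k : ℝ) + 1)) ^ 2) (x * x)) atTop
      (𝓝 (if t < x then 1 else 0)) := by
  refine tendsto_const_nhds.congr' ?_
  split_ifs with h
  · have h1 : ∀ᶠ k : ℕ in atTop, 1 / ((k : ℝ) + 1) < x - t :=
      tendsto_one_div_add_atTop_nhds_zero_nat.eventually_lt_const (by linarith)
    filter_upwards [h1] with k hk
    have h2 : (t + 1 / ((k : ℝ) + 1)) ^ 2 < x * x := by
      rw [← sq]
      exact pow_lt_pow_left₀ (by linarith) (by positivity) two_ne_zero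
    simp only [halfStep, if_pos h2]
  · refine Eventually.of_forall fun k => ?_
    have h2 : x * x < (t + 1 / ((k : ℝ) + 1)) ^ 2 := by
      rw [← sq]
      have : 0 < 1 / ((k : ℝ) + 1) := by positivity
      exact pow_lt_pow_left₀ (by linarith) hx two_ne_zero
    simp only [halfStep, if_neg h2.le.not_gt, if_neg h2.ne]

/-- An iterated pointwise limit of continuous maps: first the power `k` tends to infinity at fixed
level `τ j`, then `τ j` decreases to `t ^ 2`. -/
theorem measurable_svt {t : ℝ} (ht : 0 < t) (a b : Fin n) :
    Measurable fun y : Fin n → Fin n → ℝ => svt t (Matrix.of y) a b := by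
  let τ : ℕ → ℝ := fun j => (t + 1 / ((j : ℝ) + 1)) ^ 2
  have hτ : ∀ j, 0 < τ j := fun j => by positivity
  choose s u v h using fun y : Fin n → Fin n → ℝ => exists_isSVD (Matrix.of y)
  have h1 : ∀ j k, Measurable fun y : Fin n → Fin n → ℝ => smoothSvt (τ j) k (Matrix.of y) a b := by
    intro j k
    have hc : Continuous fun y : Fin n → Fin n → ℝ => smoothSvt (τ j) k (Matrix.of y) a b :=
      (continuous_smoothSvt (hτ j) k).matrix_elem a b
    exact hc.measurable
  have h2 : ∀ j, Measurable fun y =>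
      spectralSum (fun i => s y i * halfStep (τ j) (s y i * s y i)) (u y) (v y) a b := by
    intro j
    refine measurable_of_tendsto_metrizable (h1 j) (tendsto_pi_nhds.mpr fun y => ?_)
    simp only [smoothSvt_eq (h y) (hτ j)]
    exact tendsto_spectralSum_apply
      (fun i => (tendsto_halfStep (hτ j) (mul_self_nonneg _)).const_mul _) a b
  refine measurable_of_tendsto_metrizable h2 (tendsto_pi_nhds.mpr fun y => ?_)
  simp only [svt_eq_spectralSum (h y)]
  exact tendsto_spectralSum_apply
    (fun i => (tendsto_halfStep_sq ht ((h y).nonneg i)).const_mul _) a b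

end Measurability

/-! ### Deterministic oracle inequality for cross-validation -/

section Deterministic

variable {n : ℕ}

/-- Here `e` is the noise, `x` the error of the selected estimator and `z` that of the oracle.
Expanding the squares gives `‖x‖² ≤ ‖z‖² + 2 ⟨x - z, e⟩` on `I`; the cross term is at most `4 R + ‖x
- z‖² / 4` by AM-GM, and `‖x - z‖² ≤ 2 ‖x‖² + 2 ‖z‖²` lets half of `‖x‖²` be absorbed. -/
theorem sum_indicator_sub_sq_le {ι : Type*} [Fintype ι] (I : Set ι) (e x z : ι → ℝ) {R : ℝ} (hR0 : 0 ≤ R)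
    (hmin : ∑ p, I.indicator (fun p => (e p - x p) ^ 2) p
      ≤ ∑ p, I.indicator (fun p => (e p - z p) ^ 2) p)
    (hR : (∑ p, I.indicator (fun p => (x p - z p) * e p) p) ^ 2
      ≤ R * ∑ p, I.indicator (fun p => (x p - z p) ^ 2) p) :
    ∑ p, I.indicator (fun p => x p ^ 2) p
      ≤ 3 * ∑ p, I.indicator (fun p => z p ^ 2) p + 8 * R := by
  classical
  simp only [Set.indicator_apply, ← Finset.sum_filter] at *
  set S := Finset.univ.filter fun p => p ∈ I
  set q := ∑ p ∈ S, (x p - z p) * e p with hq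
  set A := ∑ p ∈ S, (x p - z p) ^ 2 with hA
  have hA0 : 0 ≤ A := Finset.sum_nonneg fun _ _ => sq_nonneg _
  have e1 : ∑ p ∈ S, (e p - x p) ^ 2 - ∑ p ∈ S, (e p - z p) ^ 2
      = ∑ p ∈ S, x p ^ 2 - ∑ p ∈ S, z p ^ 2 - 2 * q := by
    rw [hq, Finset.mul_sum, ← Finset.sum_sub_distrib, ← Finset.sum_sub_distrib,
      ← Finset.sum_sub_distrib]
    exact Finset.sum_congr rfl fun p _ => by ring
  have e2 : A ≤ 2 * ∑ p ∈ S, x p ^ 2 + 2 * ∑ p ∈ S, z p ^ 2 := by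
    rw [hA, Finset.mul_sum, Finset.mul_sum, ← Finset.sum_add_distrib]
    exact Finset.sum_le_sum fun p _ => by nlinarith [sq_nonneg (x p + z p)]
  have e3 : 2 * q ≤ 4 * R + A / 4 := by
    refine le_of_sq_le_sq ?_ (by positivity)
    nlinarith [sq_nonneg (4 * R - A / 4)]
  linarith

theorem frobSq_eq_sum (A : Matrix (Fin n) (Fin n) ℝ) :
    frobSq A = ∑ p : Fin n × Fin n, A p.1 p.2 ^ 2 :=
  (Fintype.sum_prod_type fun p : Fin n × Fin n => A p.1 p.2 ^ 2).symm

theorem sum_indicator_sq_le_frobSq (I : Set (Fin n × Fin n)) (A : Matrix (Fin n) (Fin n) ℝ) :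
    ∑ p, I.indicator (fun p => A p.1 p.2 ^ 2) p ≤ frobSq A := by
  rw [frobSq_eq_sum]
  exact Finset.sum_le_sum fun p _ => Set.indicator_le_self' (fun _ _ => sq_nonneg _) p

theorem frobSq_glue_sub (I : Set (Fin n × Fin n)) (A B θ : Matrix (Fin n) (Fin n) ℝ) :
    frobSq (glue I A B - θ) = ∑ p, I.indicator (fun p => (A p.1 p.2 - θ p.1 p.2) ^ 2) p
      + ∑ p, Iᶜ.indicator (fun p => (B p.1 p.2 - θ p.1 p.2) ^ 2) p := by
  classical
  rw [frobSq_eq_sum, ← Finset.sum_add_distrib]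
  refine Finset.sum_congr rfl fun p _ => ?_
  by_cases hp : p ∈ I <;> simp [glue, hp]

/-- On the fold `I`, the noise correlates strongly with the difference between one of the
completion estimators over the grid and the one with threshold `t₀`. -/
def FoldNoiseLarge (I : Set (Fin n × Fin n)) (N : ℕ) (t₀ : ℝ) (θ : Matrix (Fin n) (Fin n) ℝ)
    (R : ℝ) (x : Fin n × Fin n → ℝ) : Prop :=
  ∃ k ≤ N,
    R * ∑ p, I.indicator (fun p => (completion Iᶜ (2 ^ k) (θ + Matrix.of fun i j => x (i, j)) p.1 p.2
        - completion Iᶜ t₀ (θ + Matrix.of fun i j => x (i, j)) p.1 p.2) ^ 2) p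
      < (∑ p, I.indicator (fun p =>
          (completion Iᶜ (2 ^ k) (θ + Matrix.of fun i j => x (i, j)) p.1 p.2
            - completion Iᶜ t₀ (θ + Matrix.of fun i j => x (i, j)) p.1 p.2) * x p) p) ^ 2

theorem fold_error_le {I : Set (Fin n × Fin n)} {N : ℕ} {t₀ t R : ℝ}
    {θ y : Matrix (Fin n) (Fin n) ℝ} {x : Fin n × Fin n → ℝ} (hR0 : 0 ≤ R)
    (hy : y = θ + Matrix.of fun i j => x (i, j)) (h : ¬ FoldNoiseLarge I N t₀ θ R x)
    (ht₀ : t₀ ∈ grid N) (ht : IsArgmin (cvError I y) (grid N) t) :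
    ∑ p, I.indicator (fun p => (completion Iᶜ t y p.1 p.2 - θ p.1 p.2) ^ 2) p
      ≤ 3 * frobSq (completion Iᶜ t₀ y - θ) + 8 * R := by
  obtain ⟨⟨k, hk, rfl⟩, hmin⟩ := ht
  simp only [FoldNoiseLarge, not_exists, not_and, not_lt, ← hy] at h
  have h1 := hmin ht₀
  have hxy : ∀ p : Fin n × Fin n, y p.1 p.2 = θ p.1 p.2 + x p := fun p => by simp [hy]
  have key := sum_indicator_sub_sq_le I x
    (fun p => completion Iᶜ (2 ^ k) y p.1 p.2 - θ p.1 p.2)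
    (fun p => completion Iᶜ t₀ y p.1 p.2 - θ p.1 p.2) hR0 ?_ ?_
  · refine key.trans ?_
    have := sum_indicator_sq_le_frobSq I (completion Iᶜ t₀ y - θ)
    simp only [Matrix.sub_apply] at this
    linarith
  · have he : ∀ r, cvError I y r
        = ∑ p, I.indicator (fun p => (x p - (completion Iᶜ r y p.1 p.2 - θ p.1 p.2)) ^ 2) p := by
      intro r
      unfold cvError
      have : (fun p : Fin n × Fin n => (y p.1 p.2 - completion Iᶜ r y p.1 p.2) ^ 2)
          = fun p => (x p - (completion Iᶜ r y p.1 p.2 - θ p.1 p.2)) ^ 2 := by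
        funext p
        rw [hxy]
        ring
      rw [this]
    rw [← he, ← he]
    exact h1
  · simpa only [sub_sub_sub_cancel_right] using h k hk

/-- The two folds give `6 F + 16 R` for the glued matrix `G`. Since the selected estimate is at
least as close to `G` as the oracle `svt t₀ y`, passing from `θ` to `G` and back doubles squared
errors twice. -/
theorem cvsvt_error_le {I : Set (Fin n × Fin n)} {N : ℕ} {t₀ R F : ℝ}
    {θ y est : Matrix (Fin n) (Fin n) ℝ} {x : Fin n × Fin n → ℝ} (hR0 : 0 ≤ R)
    (hy : y = θ + Matrix.of fun i j => x (i, j)) (h₁ : ¬ FoldNoiseLarge I N t₀ θ R x)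
    (h₂ : ¬ FoldNoiseLarge Iᶜ N t₀ θ R x) (ht₀ : t₀ ∈ grid N)
    (hF : frobSq (svt t₀ y - θ) ≤ F) (hF₁ : frobSq (completion I t₀ y - θ) ≤ F)
    (hF₂ : frobSq (completion Iᶜ t₀ y - θ) ≤ F) (hest : IsCVSVT N I y est) :
    frobSq (est - θ) ≤ 40 * F + 96 * R := by
  obtain ⟨t₁, t₂, t, ht₁, ht₂, ht, rfl⟩ := hest
  set G := glue I (completion Iᶜ t₁ y) (completion I t₂ y)
  have e1 := fold_error_le hR0 hy h₁ ht₀ ht₁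
  have e2 := fold_error_le hR0 hy h₂ ht₀ ht₂
  rw [compl_compl] at e2
  have e3 : frobSq (G - θ) ≤ 6 * F + 16 * R := by
    rw [frobSq_glue_sub]
    linarith
  have e4 : frobSq (svt t y - G) ≤ frobSq (svt t₀ y - G) := ht.2 ht₀
  have e5 := frobSq_add_le (svt t y - G) (G - θ)
  have e6 := frobSq_add_le (svt t₀ y - θ) (θ - G)
  have e7 : frobSq (θ - G) = frobSq (G - θ) := by
    simp only [frobSq, Matrix.sub_apply]
    exact Finset.sum_congr rfl fun i _ => Finset.sum_congr rfl fun j _ => by ring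
  rw [sub_add_sub_cancel] at e5 e6
  linarith

end Deterministic

/-! ### Union bound over the net -/

section NetEvent

variable {n : ℕ}

/-- Some bilinear form of `A` at points of the net `T` has square larger than `r`. -/
def NetLarge (T : Finset (EuclideanSpace ℝ (Fin n))) (r : ℝ) (A : Fin n × Fin n → ℝ) : Prop :=
  ∃ a ∈ T, ∃ b ∈ T, r < (∑ p : Fin n × Fin n, (a.ofLp p.1 * b.ofLp p.2) * A p) ^ 2

theorem opBound_of_not_netLarge {T : Finset (EuclideanSpace ℝ (Fin n))}
    (hT : ∀ x : EuclideanSpace ℝ (Fin n), ‖x‖ ≤ 1 → ∃ s ∈ T, ‖x - s‖ ≤ 1 / 2)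
    {r B : ℝ} (hB : 0 ≤ B) (hr : r ≤ B ^ 2) {A : Fin n × Fin n → ℝ} (h : ¬ NetLarge T r A) :
    OpBound (Matrix.of fun i j => A (i, j)) (4 * B) := by
  simp only [NetLarge, not_exists, not_and, not_lt] at h
  refine opBound_of_net hT fun a ha b hb => ?_
  rw [inner_toEuclideanLin_eq_sum]
  exact le_of_sq_le_sq ((h a ha b hb).trans hr) hB

theorem measurableSet_netLarge (T : Finset (EuclideanSpace ℝ (Fin n))) (r : ℝ)
    (c : Fin n × Fin n → ℝ) : MeasurableSet {x : Fin n × Fin n → ℝ | NetLarge T r (c * x)} := by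
  have : {x : Fin n × Fin n → ℝ | NetLarge T r (c * x)} = ⋃ a ∈ T, ⋃ b ∈ T,
      {x | r < (∑ p : Fin n × Fin n, (a.ofLp p.1 * b.ofLp p.2) * (c * x) p) ^ 2} := by
    ext x
    simp [NetLarge]
  rw [this]
  refine Finset.measurableSet_biUnion _ fun a _ => Finset.measurableSet_biUnion _ fun b _ => ?_
  refine measurableSet_lt measurable_const (Measurable.pow_const ?_ 2)
  refine Finset.measurable_sum _ fun p _ => ?_
  simp only [Pi.mul_apply]
  fun_prop

/-- The exponent 7 beats the `25 ^ n ≤ exp (4 n)` pairs with `exp (-3 n)` to spare; since `n ≥ 1`,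
`exp (2 n) ≥ 3` turns this into the factor `2 / 3`. Three such events, one for each masked noise and
one for the signal, then add up to exactly `2 exp (-n)`. -/
theorem card_mul_exp_le {m : ℕ} (hn : 1 ≤ n) (hm : m ≤ 5 ^ n) :
    ((m * m : ℕ) : ℝ) * (2 * Real.exp (-(7 * n))) ≤ 2 / 3 * Real.exp (-n) := by
  have h1 : ((m * m : ℕ) : ℝ) ≤ 25 ^ n := by
    have : m * m ≤ 25 ^ n := by
      calc m * m ≤ 5 ^ n * 5 ^ n := Nat.mul_le_mul hm hm
        _ = 25 ^ n := by rw [← mul_pow]; norm_num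
    exact_mod_cast this
  have he : (2.7 : ℝ) < Real.exp 1 := by linarith [Real.exp_one_gt_d9]
  have h2 : (25 : ℝ) ^ n ≤ Real.exp (4 * n) := by
    have : (25 : ℝ) ≤ Real.exp 4 := by
      have h3 : Real.exp 4 = Real.exp 1 ^ 4 := by rw [← Real.exp_nat_mul]; norm_num
      rw [h3]
      calc (25 : ℝ) ≤ 2.7 ^ 4 := by norm_num
        _ ≤ _ := by gcongr
    calc (25 : ℝ) ^ n ≤ Real.exp 4 ^ n := by gcongr
      _ = _ := by rw [← Real.exp_nat_mul, mul_comm]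
  have h4 : (3 : ℝ) ≤ Real.exp (2 * n) := by
    have h5 : (1 : ℝ) ≤ n := by exact_mod_cast hn
    linarith [Real.add_one_le_exp (2 * (n : ℝ))]
  have h6 : Real.exp (4 * n) * Real.exp (-(7 * n)) * Real.exp (2 * n) = Real.exp (-n) := by
    rw [← Real.exp_add, ← Real.exp_add]; congr 1; ring
  calc ((m * m : ℕ) : ℝ) * (2 * Real.exp (-(7 * n)))
      ≤ Real.exp (4 * n) * (2 * Real.exp (-(7 * n))) := by gcongr; exact h1.trans h2
    _ ≤ 2 / 3 * (Real.exp (4 * n) * Real.exp (-(7 * n)) * Real.exp (2 * n)) := by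
      have : 0 < Real.exp (4 * n) * Real.exp (-(7 * n)) := by positivity
      nlinarith
    _ = _ := by rw [h6]

theorem measure_netLarge_le {Ω : Type*} [MeasurableSpace Ω] {μ : Measure Ω} (hn : 1 ≤ n)
    {T : Finset (EuclideanSpace ℝ (Fin n))} (hcard : T.card ≤ 5 ^ n) (hT : ∀ x ∈ T, ‖x‖ ≤ 1)
    {X : Fin n × Fin n → Ω → ℝ} (hind : iIndepFun X μ) {κ : NNReal}
    (hX : ∀ p, HasSubgaussianMGF (X p) κ μ) {c : Fin n × Fin n → ℝ} {m : ℝ}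
    (hc : ∀ p, |c p| ≤ m) :
    μ {ω | NetLarge T (2 * κ * (7 * n) * m ^ 2) (c * fun p => X p ω)}
      ≤ ENNReal.ofReal (2 / 3 * Real.exp (-n)) := by
  have hsub : {ω | NetLarge T (2 * κ * (7 * n) * m ^ 2) (c * fun p => X p ω)} ⊆
      ⋃ q ∈ T ×ˢ T, {ω | 2 * κ * (7 * n) * ∑ p : Fin n × Fin n, (q.1.ofLp p.1 * q.2.ofLp p.2 * c p) ^ 2
        < (∑ p : Fin n × Fin n, q.1.ofLp p.1 * q.2.ofLp p.2 * c p * X p ω) ^ 2} := by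
    rintro ω ⟨a, ha, b, hb, hab⟩
    simp only [Set.mem_iUnion]
    refine ⟨(a, b), Finset.mem_product.mpr ⟨ha, hb⟩, ?_⟩
    have h1 : ∑ p : Fin n × Fin n, (a.ofLp p.1 * b.ofLp p.2 * c p) ^ 2 ≤ m ^ 2 := by
      calc ∑ p : Fin n × Fin n, (a.ofLp p.1 * b.ofLp p.2 * c p) ^ 2
          ≤ ∑ p : Fin n × Fin n, (a.ofLp p.1 * b.ofLp p.2) ^ 2 * m ^ 2 := by
            refine Finset.sum_le_sum fun p _ => ?_
            rw [mul_pow]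
            have : c p ^ 2 ≤ m ^ 2 := by
              rw [← sq_abs]
              exact pow_le_pow_left₀ (abs_nonneg _) (hc p) 2
            gcongr
        _ ≤ 1 * m ^ 2 := by
            rw [← Finset.sum_mul]
            gcongr
            exact sum_mul_sq_le_one (hT a ha) (hT b hb)
        _ = m ^ 2 := one_mul _
    simp only [Set.mem_ofPred_eq]
    refine lt_of_le_of_lt (b := 2 * κ * (7 * n) * m ^ 2) (by gcongr) ?_
    simpa only [Pi.mul_apply, mul_assoc] using hab
  refine (measure_mono hsub).trans ((measure_biUnion_finset_le _ _).trans ?_)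
  refine (Finset.sum_le_card_nsmul _ _ _ fun q _ =>
    measure_lt_sq_sum_le hind hX (fun p => q.1.ofLp p.1 * q.2.ofLp p.2 * c p)
      (L := 7 * n) (by positivity)).trans ?_
  rw [Finset.card_product, nsmul_eq_mul, ← ENNReal.ofReal_natCast,
    ← ENNReal.ofReal_mul (by positivity)]
  exact ENNReal.ofReal_le_ofReal (card_mul_exp_le hn hcard)

end NetEvent

/-! ### Noise on one fold against estimators built on the other -/

section FoldEvent

variable {n : ℕ}

theorem measurable_completion {α : Type*} [MeasurableSpace α] (I : Set (Fin n × Fin n)) {t : ℝ}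
    (ht : 0 < t) {h : α → Matrix (Fin n) (Fin n) ℝ} (hh : ∀ i j, Measurable fun a => h a i j)
    (i j : Fin n) : Measurable fun a => completion I t (h a) i j := by
  classical
  refine (measurable_svt ht i j).comp (g := fun y : Fin n → Fin n → ℝ => svt t (Matrix.of y) i j)
    (f := fun a k l => zeroDouble I (h a) k l) ?_
  refine measurable_pi_lambda _ fun k => measurable_pi_lambda _ fun l => ?_
  simp only [zeroDouble, Matrix.of_apply, Set.indicator_apply]
  split_ifs
  · exact (hh k l).const_mul 2
  · exact measurable_const

theorem completion_congr {I : Set (Fin n × Fin n)} (t : ℝ) {y y' : Matrix (Fin n) (Fin n) ℝ}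
    (h : ∀ p ∈ I, y p.1 p.2 = y' p.1 p.2) : completion I t y = completion I t y' := by
  classical
  unfold completion
  congr 1
  ext i j
  simp only [zeroDouble, Matrix.of_apply, Set.indicator_apply]
  split_ifs with hI
  · rw [h (i, j) hI]
  · rfl

theorem measurableSet_foldNoiseLarge (I : Set (Fin n × Fin n)) (N : ℕ) {t₀ : ℝ} (ht₀ : 0 < t₀)
    (θ : Matrix (Fin n) (Fin n) ℝ) (R : ℝ) :
    MeasurableSet {x : Fin n × Fin n → ℝ | FoldNoiseLarge I N t₀ θ R x} := by
  classical
  have hm : ∀ {t : ℝ}, 0 < t → ∀ i j, Measurable fun x : Fin n × Fin n → ℝ =>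
      completion Iᶜ t (θ + Matrix.of fun i j => x (i, j)) i j := fun ht i j =>
    measurable_completion _ ht (fun k l => by
      simp only [Matrix.add_apply, Matrix.of_apply]; fun_prop) i j
  simp only [FoldNoiseLarge, Set.ofPred_exists]
  refine MeasurableSet.iUnion fun k => ?_
  simp only [Set.ofPred_and]
  refine (MeasurableSet.const _).inter (measurableSet_lt ?_ ?_)
  · refine (Finset.measurable_sum _ fun p _ => ?_).const_mul R
    simp only [Set.indicator_apply]
    split_ifs
    · exact ((hm (by positivity) _ _).sub (hm ht₀ _ _)).pow_const 2
    · exact measurable_const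
  · refine (Finset.measurable_sum _ fun p _ => ?_).pow_const 2
    simp only [Set.indicator_apply]
    split_ifs
    · exact ((hm (by positivity) _ _).sub (hm ht₀ _ _)).mul (measurable_pi_apply p)
    · exact measurable_const

/-- Both completion estimators read only the entries off `I`. Freezing the noise there makes their
difference a deterministic coefficient vector, and the tail bound for linear forms applies to the
independent noise on `I`, followed by a union over the `N + 1` grid points. -/
theorem measure_foldNoiseLarge_le {Ω : Type*} [MeasurableSpace Ω] {μ : Measure Ω}
    {X : Fin n × Fin n → Ω → ℝ} (hXm : ∀ p, Measurable (X p)) (hind : iIndepFun X μ) {κ : NNReal}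
    (hX : ∀ p, HasSubgaussianMGF (X p) κ μ) (I : Set (Fin n × Fin n)) (N : ℕ) {t₀ : ℝ}
    (ht₀ : 0 < t₀) (θ : Matrix (Fin n) (Fin n) ℝ) {L : ℝ} (hL : 0 ≤ L) :
    μ {ω | FoldNoiseLarge I N t₀ θ (2 * κ * L) fun p => X p ω}
      ≤ ENNReal.ofReal ((N + 1) * (2 * Real.exp (-L))) := by
  classical
  have := hind.isProbabilityMeasure
  set S : Finset (Fin n × Fin n) := Finset.univ.filter fun p => p ∈ I with hS
  have hmemS : ∀ p, p ∈ S ↔ p ∈ I := fun p => by simp [hS]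
  -- The zeros filled in on `I` are immaterial, since `completion Iᶜ` ignores these entries.
  let ext : (↥Sᶜ → ℝ) → Fin n → Fin n → ℝ := fun z i j =>
    if h : (i, j) ∈ Sᶜ then z ⟨(i, j), h⟩ else 0
  let D : ℕ → (↥Sᶜ → ℝ) → Fin n × Fin n → ℝ := fun k z p =>
    completion Iᶜ (2 ^ k) (θ + Matrix.of (ext z)) p.1 p.2
      - completion Iᶜ t₀ (θ + Matrix.of (ext z)) p.1 p.2
  have hext : ∀ i j, Measurable fun z => (θ + Matrix.of (ext z)) i j := by
    intro i j
    simp only [Matrix.add_apply, Matrix.of_apply, ext]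
    split_ifs <;> fun_prop
  have hD : ∀ k p, Measurable fun z => D k z p := fun k p =>
    (measurable_completion _ (by positivity) hext _ _).sub (measurable_completion _ ht₀ hext _ _)
  have hDX : ∀ ω t, completion Iᶜ t (θ + Matrix.of (ext fun p : ↥Sᶜ => X p ω))
      = completion Iᶜ t (θ + Matrix.of fun i j => X (i, j) ω) := by
    intro ω t
    refine completion_congr t fun p hp => ?_
    have hp' : p ∉ S := by rw [hmemS]; exact hp
    simp [ext, hp']
  have hindXZ := hind.indepFun_finset S Sᶜ disjoint_compl_right hXm
  have hk : ∀ k, μ {ω | 2 * κ * L * ∑ p : S, D k (fun p : ↥Sᶜ => X p ω) p ^ 2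
      < (∑ p : S, D k (fun p : ↥Sᶜ => X p ω) p * X p ω) ^ 2}
      ≤ ENNReal.ofReal (2 * Real.exp (-L)) := by
    intro k
    refine measure_prodMk_mem_le_of_indepFun (X := fun ω (p : S) => X p ω)
      (Z := fun ω (p : ↥Sᶜ) => X p ω) (by fun_prop) (by fun_prop) hindXZ
      (B := {q | 2 * κ * L * ∑ p : S, D k q.2 p ^ 2 < (∑ p : S, D k q.2 p * q.1 p) ^ 2}) ?_ ?_
    · have hD' : ∀ p : S, Measurable fun q : (S → ℝ) × (↥Sᶜ → ℝ) => D k q.2 p := fun p =>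
        (hD k p).comp measurable_snd
      refine measurableSet_lt ?_ ?_
      · exact (Finset.measurable_sum _ fun p _ => (hD' p).pow_const 2).const_mul _
      · exact (Finset.measurable_sum _ fun p _ => (hD' p).mul (by fun_prop)).pow_const 2
    · intro z
      exact measure_lt_sq_sum_le (hind.precomp Subtype.val_injective) (fun p : S => hX p)
        (fun p : S => D k z p) hL
  have hsub : {ω | FoldNoiseLarge I N t₀ θ (2 * κ * L) fun p => X p ω} ⊆
      ⋃ k ∈ Finset.range (N + 1), {ω | 2 * κ * L * ∑ p : S, D k (fun p : ↥Sᶜ => X p ω) p ^ 2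
      < (∑ p : S, D k (fun p : ↥Sᶜ => X p ω) p * X p ω) ^ 2} := by
    rintro ω ⟨k, hkN, h⟩
    simp only [Set.mem_iUnion]
    refine ⟨k, Finset.mem_range.mpr (by omega), ?_⟩
    simp only [Set.mem_ofPred_eq, D, hDX]
    simp only [Set.indicator_apply, ← Finset.sum_filter, ← hS] at h
    rw [← Finset.sum_coe_sort S, ← Finset.sum_coe_sort S] at h
    exact h
  refine (measure_mono hsub).trans ((measure_biUnion_finset_le _ _).trans ?_)
  refine (Finset.sum_le_card_nsmul _ _ _ fun k _ => hk k).trans ?_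
  rw [Finset.card_range, nsmul_eq_mul, ← ENNReal.ofReal_natCast,
    ← ENNReal.ofReal_mul (by positivity)]
  push_cast
  exact le_rfl

end FoldEvent

/-! ### Combining the events and fitting the constants -/

section Assembly

variable {n : ℕ}

/-- The indicator of the indices at which the coin shows `b`. -/
noncomputable def coinMask (w : Fin n × Fin n → Bool) (b : Bool) (p : Fin n × Fin n) : ℝ :=
  if w p = b then 1 else 0

theorem abs_coinMask_le (w : Fin n × Fin n → Bool) (b : Bool) (p : Fin n × Fin n) :
    |coinMask w b p| ≤ 1 := by
  unfold coinMask
  split_ifs <;> simp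

/-- The sign of a coin. -/
def coinSign (b : Bool) : ℝ := if b = true then 1 else -1

section OpBounds

variable {θ : Matrix (Fin n) (Fin n) ℝ} {x : Fin n × Fin n → ℝ} {w : Fin n × Fin n → Bool}
  {q t : ℝ}

/-- The full noise is the sum of its two masked parts, so it needs no exceptional event of its own.
-/
theorem opBound_observed_sub (hq : 0 ≤ q) (ht : 128 * q ≤ t)
    (hN : ∀ b, OpBound (Matrix.of fun i j => (coinMask w b * x) (i, j)) (24 * q)) :
    OpBound ((θ + Matrix.of fun i j => x (i, j)) - θ) (t / 2) := by
  have h := ((hN true).add (hN false)).mono (B' := t / 2) (by linarith)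
  convert h using 1
  ext i j
  cases hw : w (i, j) <;> simp [coinMask, hw]

/-- Doubling on the fold and erasing off it changes `θ` by `+θ` and `-θ` respectively, that is, by
`θ` times the coin signs; the noise appears masked and doubled. The requirement `16 q + 2 * 24 q ≤ t
/ 2` is the source of 128. -/
theorem opBound_zeroDouble_sub (ht : 128 * q ≤ t)
    (hS : OpBound (Matrix.of fun i j => θ i j * coinSign (w (i, j))) (16 * q))
    (hN : ∀ b, OpBound (Matrix.of fun i j => (coinMask w b * x) (i, j)) (24 * q)) :
    OpBound (zeroDouble {p | w p = true} (θ + Matrix.of fun i j => x (i, j)) - θ) (t / 2) := by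
  classical
  have h := (hS.add ((hN true).smul zero_le_two)).mono (B' := t / 2) (by linarith)
  convert h using 1
  ext i j
  cases hw : w (i, j) <;> simp [coinMask, coinSign, zeroDouble, hw]
  ring

theorem opBound_zeroDouble_compl_sub (ht : 128 * q ≤ t)
    (hS : OpBound (Matrix.of fun i j => θ i j * coinSign (w (i, j))) (16 * q))
    (hN : ∀ b, OpBound (Matrix.of fun i j => (coinMask w b * x) (i, j)) (24 * q)) :
    OpBound (zeroDouble {p | w p = true}ᶜ (θ + Matrix.of fun i j => x (i, j)) - θ) (t / 2) := by
  classical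
  have h := (hS.neg.add ((hN false).smul zero_le_two)).mono (B' := t / 2) (by linarith)
  convert h using 1
  ext i j
  cases hw : w (i, j) <;> simp [coinMask, coinSign, zeroDouble, hw]
  ring

end OpBounds

theorem abs_apply_le_maxAbs (A : Matrix (Fin n) (Fin n) ℝ) (i j : Fin n) : |A i j| ≤ maxAbs A :=
  le_ciSup (f := fun p : Fin n × Fin n => |A p.1 p.2|) (Set.finite_range _).bddAbove (i, j)

theorem maxAbs_nonneg (A : Matrix (Fin n) (Fin n) ℝ) : 0 ≤ maxAbs A :=
  Real.iSup_nonneg fun _ => abs_nonneg _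

variable {Ω : Type*} [MeasurableSpace Ω] {μ : Measure Ω} [IsProbabilityMeasure μ]

/-- Hoeffding's lemma on an interval of length 2. -/
theorem hasSubgaussianMGF_coinSign {V : Ω → Bool} (hV : Measurable V)
    (h : μ {ω | V ω = true} = 1 / 2) : HasSubgaussianMGF (fun ω => coinSign (V ω)) 1 μ := by
  have hm : Measurable fun ω => coinSign (V ω) := (measurable_of_countable coinSign).comp hV
  have hb : ∀ᵐ ω ∂μ, coinSign (V ω) ∈ Set.Icc (-1 : ℝ) 1 := ae_of_all _ fun ω => by
    unfold coinSign; split_ifs <;> simp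
  have hset : MeasurableSet {ω | V ω = true} := hV (measurableSet_singleton true)
  have h0 : ∫ ω, coinSign (V ω) ∂μ = 0 := by
    have he : (fun ω => coinSign (V ω))
        = fun ω => 2 * ({ω | V ω = true}.indicator (fun _ => (1 : ℝ)) ω) - 1 := by
      funext ω
      cases hω : V ω <;> simp [coinSign, hω]
      norm_num
    have hreal : μ.real {ω | V ω = true} = 1 / 2 := by simp [Measure.real, h]
    rw [he, integral_sub (((integrable_const (1 : ℝ)).indicator hset).const_mul 2)
      (integrable_const 1), integral_const_mul, integral_indicator_const _ hset, hreal]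
    simp
  have h1 := hasSubgaussianMGF_of_mem_Icc_of_integral_eq_zero hm.aemeasurable hb h0
  convert h1 using 1
  have h2 : ‖(1 : ℝ) - -1‖₊ = 2 := by
    rw [← NNReal.coe_inj, coe_nnnorm]
    norm_num
  rw [h2]
  norm_num

/-- The exceptional event for the noise `x` when the folds are given by the coins `w`. -/
def NoiseBad (T : Finset (EuclideanSpace ℝ (Fin n))) (r : ℝ) (N : ℕ) (t₀ : ℝ)
    (θ : Matrix (Fin n) (Fin n) ℝ) (R : ℝ) (x : Fin n × Fin n → ℝ)
    (w : Fin n × Fin n → Bool) : Prop :=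
  (∃ b, NetLarge T r (coinMask w b * x)) ∨
    FoldNoiseLarge {p | w p = true} N t₀ θ R x ∨ FoldNoiseLarge {p | w p = true}ᶜ N t₀ θ R x

theorem measurableSet_noiseBad (T : Finset (EuclideanSpace ℝ (Fin n))) (r : ℝ) (N : ℕ) {t₀ : ℝ}
    (ht₀ : 0 < t₀) (θ : Matrix (Fin n) (Fin n) ℝ) (R : ℝ) :
    MeasurableSet {z : (Fin n × Fin n → ℝ) × (Fin n × Fin n → Bool) |
      NoiseBad T r N t₀ θ R z.1 z.2} := by
  have h : ∀ w, MeasurableSet {x | NoiseBad T r N t₀ θ R x w} := by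
    intro w
    simp only [NoiseBad, Set.ofPred_or, Set.ofPred_exists]
    exact (MeasurableSet.iUnion fun b => measurableSet_netLarge T r _).union
      ((measurableSet_foldNoiseLarge _ N ht₀ θ R).union
        (measurableSet_foldNoiseLarge _ N ht₀ θ R))
  have he : {z : (Fin n × Fin n → ℝ) × (Fin n × Fin n → Bool) | NoiseBad T r N t₀ θ R z.1 z.2}
      -- There are finitely many coin patterns, so joint measurability reduces to each slice.
      = ⋃ w, (Prod.fst ⁻¹' {x | NoiseBad T r N t₀ θ R x w}) ∩ (Prod.snd ⁻¹' {w}) := by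
    ext ⟨x, w⟩
    simp
  rw [he]
  exact MeasurableSet.iUnion fun w =>
    (measurable_fst (h w)).inter (measurable_snd (measurableSet_singleton w))

variable {σ : ℝ} {ε : Fin n → Fin n → Ω → ℝ} {W : Fin n → Fin n → Ω → Bool}
  {T : Finset (EuclideanSpace ℝ (Fin n))}

/-- The coins are independent of the noise, so they may be frozen and every bound proved for
deterministic folds. The variance proxy `2 σ²` turns the tail thresholds into `28 σ² n` and `4 σ²
L`. -/
theorem measure_noiseBad_le (hσ : 0 ≤ σ) (hM : IsModel μ σ ε W) (hn : 1 ≤ n)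
    (hcard : T.card ≤ 5 ^ n) (hT : ∀ x ∈ T, ‖x‖ ≤ 1) (N : ℕ) {t₀ : ℝ} (ht₀ : 0 < t₀)
    (θ : Matrix (Fin n) (Fin n) ℝ) {L : ℝ} (hL : 0 ≤ L) :
    μ {ω | NoiseBad T (28 * σ ^ 2 * n) N t₀ θ (4 * σ ^ 2 * L)
        (fun p => ε p.1 p.2 ω) (fun p => W p.1 p.2 ω)}
      ≤ ENNReal.ofReal (4 / 3 * Real.exp (-n) + 4 * (N + 1) * Real.exp (-L)) := by
  have hε : ∀ p : Fin n × Fin n, Measurable (ε p.1 p.2) := fun p => hM.measurable_noise _ _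
  have hW : ∀ p : Fin n × Fin n, Measurable (W p.1 p.2) := fun p => hM.measurable_coin _ _
  have hsub : ∀ p : Fin n × Fin n,
      HasSubgaussianMGF (ε p.1 p.2) (Real.toNNReal (2 * σ ^ 2)) μ := fun p =>
    hasSubgaussianMGF_of_subGaussianNorm (hε p) (hM.mean_zero _ _) hσ (hM.subGaussian _ _)
  have hκ : ((Real.toNNReal (2 * σ ^ 2) : NNReal) : ℝ) = 2 * σ ^ 2 :=
    Real.coe_toNNReal _ (by positivity)
  refine measure_prodMk_mem_le_of_indepFun (X := fun ω (p : Fin n × Fin n) => ε p.1 p.2 ω)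
    (Z := fun ω (p : Fin n × Fin n) => W p.1 p.2 ω) (measurable_pi_lambda _ hε)
    (measurable_pi_lambda _ hW) hM.indep.symm
    (measurableSet_noiseBad T (28 * σ ^ 2 * n) N ht₀ θ (4 * σ ^ 2 * L)) fun w => ?_
  have h1 : ∀ b, μ {ω | NetLarge T (28 * σ ^ 2 * n) (coinMask w b * fun p => ε p.1 p.2 ω)}
      ≤ ENNReal.ofReal (2 / 3 * Real.exp (-n)) := by
    intro b
    have := measure_netLarge_le hn hcard hT hM.indep_noise hsub (abs_coinMask_le w b)
    rw [hκ] at this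
    convert this using 5
    ring
  have h2 : ∀ I, μ {ω | FoldNoiseLarge I N t₀ θ (4 * σ ^ 2 * L) fun p => ε p.1 p.2 ω}
      ≤ ENNReal.ofReal ((N + 1) * (2 * Real.exp (-L))) := by
    intro I
    have := measure_foldNoiseLarge_le hε hM.indep_noise hsub I N ht₀ θ hL
    rw [hκ] at this
    convert this using 5
    ring
  have hset : {ω | ((fun p : Fin n × Fin n => ε p.1 p.2 ω), w) ∈
        {z : (Fin n × Fin n → ℝ) × (Fin n × Fin n → Bool) |
          NoiseBad T (28 * σ ^ 2 * n) N t₀ θ (4 * σ ^ 2 * L) z.1 z.2}} ⊆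
      ({ω | NetLarge T (28 * σ ^ 2 * n) (coinMask w true * fun p => ε p.1 p.2 ω)} ∪
        {ω | NetLarge T (28 * σ ^ 2 * n) (coinMask w false * fun p => ε p.1 p.2 ω)}) ∪
      ({ω | FoldNoiseLarge {p | w p = true} N t₀ θ (4 * σ ^ 2 * L) fun p => ε p.1 p.2 ω} ∪
        {ω | FoldNoiseLarge {p | w p = true}ᶜ N t₀ θ (4 * σ ^ 2 * L) fun p => ε p.1 p.2 ω}) := by
    rintro ω (⟨b, hb⟩ | h | h)
    · cases b
      · exact Or.inl (Or.inr hb)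
      · exact Or.inl (Or.inl hb)
    · exact Or.inr (Or.inl h)
    · exact Or.inr (Or.inr h)
  calc _ ≤ _ := measure_mono hset
    _ ≤ (ENNReal.ofReal (2 / 3 * Real.exp (-n)) + ENNReal.ofReal (2 / 3 * Real.exp (-n)))
        + (ENNReal.ofReal ((N + 1) * (2 * Real.exp (-L)))
          + ENNReal.ofReal ((N + 1) * (2 * Real.exp (-L)))) :=
        (measure_union_le _ _).trans (add_le_add
          ((measure_union_le _ _).trans (add_le_add (h1 _) (h1 _)))
          ((measure_union_le _ _).trans (add_le_add (h2 _) (h2 _))))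
    _ = _ := by
        rw [← ENNReal.ofReal_add (by positivity) (by positivity),
          ← ENNReal.ofReal_add (by positivity) (by positivity),
          ← ENNReal.ofReal_add (by positivity) (by positivity)]
        congr 1
        ring

theorem measure_signalBad_le (hM : IsModel μ σ ε W) (hn : 1 ≤ n)
    (hcard : T.card ≤ 5 ^ n) (hT : ∀ x ∈ T, ‖x‖ ≤ 1) (θ : Matrix (Fin n) (Fin n) ℝ) :
    μ {ω | NetLarge T (14 * maxAbs θ ^ 2 * n) fun p => θ p.1 p.2 * coinSign (W p.1 p.2 ω)}
      ≤ ENNReal.ofReal (2 / 3 * Real.exp (-n)) := by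
  have hind : iIndepFun (fun (p : Fin n × Fin n) ω => coinSign (W p.1 p.2 ω)) μ :=
    hM.indep_coin.comp (fun _ => coinSign) fun _ => measurable_of_countable _
  have := measure_netLarge_le hn hcard hT hind (κ := 1)
    (fun p => hasSubgaussianMGF_coinSign (hM.measurable_coin _ _) (hM.fair_coin _ _))
    (c := fun p => θ p.1 p.2) (m := maxAbs θ) (fun p => abs_apply_le_maxAbs θ _ _)
  have hr : 14 * maxAbs θ ^ 2 * n = 2 * ((1 : NNReal) : ℝ) * (7 * n) * maxAbs θ ^ 2 := by
    simp only [NNReal.coe_one]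
    ring
  rw [hr]
  exact this

theorem frobSq_sub_le_of_not_bad {θ : Matrix (Fin n) (Fin n) ℝ} {x : Fin n × Fin n → ℝ}
    {w : Fin n × Fin n → Bool} {N : ℕ} {t₀ R : ℝ} (hσ : 0 ≤ σ)
    (hT : ∀ x : EuclideanSpace ℝ (Fin n), ‖x‖ ≤ 1 → ∃ s ∈ T, ‖x - s‖ ≤ 1 / 2)
    (ht₀ : t₀ ∈ grid N) (ht₀' : 0 < t₀) (hq : 128 * ((maxAbs θ + σ) * √(n : ℝ)) ≤ t₀)
    (hR : 0 ≤ R)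
    (hS : ¬ NetLarge T (14 * maxAbs θ ^ 2 * n) fun p => θ p.1 p.2 * coinSign (w p))
    (hN : ¬ NoiseBad T (28 * σ ^ 2 * n) N t₀ θ R x w) {est : Matrix (Fin n) (Fin n) ℝ}
    (hest : IsCVSVT N {p | w p = true} (θ + Matrix.of fun i j => x (i, j)) est) :
    frobSq (est - θ)
      ≤ 2560 * ∑ j, min (t₀ ^ 2) (singularValue θ j ^ 2) + 96 * R := by
  have hM0 := maxAbs_nonneg θ
  simp only [NoiseBad, not_or, not_exists] at hN
  obtain ⟨hN1, hN2, hN3⟩ := hN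
  set q := (maxAbs θ + σ) * √(n : ℝ) with hqdef
  have hq0 : 0 ≤ q := by positivity
  have hsq : √(n : ℝ) ^ 2 = n := Real.sq_sqrt (Nat.cast_nonneg n)
  have hS' : OpBound (Matrix.of fun i j => θ i j * coinSign (w (i, j))) (16 * q) := by
    -- The factors 4 here and 6 below are convenient integers with `14 ≤ 4 ^ 2` and `28 ≤ 6 ^ 2`.
    have h1 := opBound_of_not_netLarge hT (B := 4 * (maxAbs θ * √(n : ℝ))) (by positivity)
      (by rw [mul_pow, mul_pow, hsq]; nlinarith [mul_nonneg (sq_nonneg (maxAbs θ)) n.cast_nonneg'])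
      hS
    refine h1.mono ?_
    have : 0 ≤ σ * √(n : ℝ) := by positivity
    rw [hqdef]
    linarith
  have hN' : ∀ b, OpBound (Matrix.of fun i j => (coinMask w b * x) (i, j)) (24 * q) := by
    intro b
    have h1 := opBound_of_not_netLarge hT (B := 6 * (σ * √(n : ℝ))) (by positivity)
      (by rw [mul_pow, mul_pow, hsq]; nlinarith [mul_nonneg (sq_nonneg σ) n.cast_nonneg'])
      (hN1 b)
    refine h1.mono ?_
    have : 0 ≤ maxAbs θ * √(n : ℝ) := by positivity
    rw [hqdef]
    linarith
  have h := cvsvt_error_le hR rfl hN2 hN3 ht₀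
    (frobSq_svt_sub_le ht₀' (opBound_observed_sub hq0 hq hN'))
    (frobSq_svt_sub_le ht₀' (opBound_zeroDouble_sub hq hS' hN'))
    (frobSq_svt_sub_le ht₀' (opBound_zeroDouble_compl_sub hq hS' hN')) hest
  linarith

theorem sum_min_sq_le {r m K : ℝ} {t₀ : ℝ} (hr : 0 ≤ r) (hK : 1 ≤ K) (h0 : 0 ≤ t₀)
    (h : t₀ ≤ 2 * (K * (m * √r))) (s : Fin n → ℝ) :
    ∑ j, min (t₀ ^ 2) (s j ^ 2) ≤ 4 * K ^ 2 * ∑ j, min (r * m ^ 2) (s j ^ 2) := by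
  rw [Finset.mul_sum]
  refine Finset.sum_le_sum fun j _ => ?_
  rw [mul_min_of_nonneg _ _ (by positivity)]
  refine min_le_min ?_ ?_
  · calc t₀ ^ 2 ≤ (2 * (K * (m * √r))) ^ 2 := by gcongr
      _ = 4 * K ^ 2 * (√r ^ 2 * m ^ 2) := by ring
      _ = _ := by rw [Real.sq_sqrt hr]
  · nlinarith [sq_nonneg (s j), mul_le_mul hK hK zero_le_one (by linarith)]

/-- With `N ≥ 3` and `δ < 1`, the ratio `N / δ` is at least 3, so constant factors disappear into
its fourth power: `4 (N + 1) / δ ≤ 8 N / δ ≤ (N / δ) ^ 4`. -/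
theorem log_le_four_mul_log {N : ℕ} (hN : 3 ≤ N) {δ : ℝ} (hδ : 0 < δ) (hδ1 : δ < 1) :
    0 ≤ Real.log (4 * (N + 1) / δ) ∧
      Real.log (4 * (N + 1) / δ) ≤ 4 * Real.log (N / δ) := by
  have hN' : (3 : ℝ) ≤ N := by exact_mod_cast hN
  have h1 : (N : ℝ) ≤ N / δ := by
    rw [le_div_iff₀ hδ]
    nlinarith
  refine ⟨Real.log_nonneg ?_, ?_⟩
  · rw [le_div_iff₀ hδ]
    linarith
  · have h2 : 4 * Real.log (N / δ) = Real.log ((N / δ) ^ 4) := by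
      rw [Real.log_pow]; norm_num
    rw [h2]
    refine Real.log_le_log (by positivity) ?_
    have h3 : 4 * ((N : ℝ) + 1) / δ ≤ 8 * (N / δ) := by
      rw [← mul_div_assoc]
      exact div_le_div_of_nonneg_right (by linarith) hδ.le
    have h4 : (8 : ℝ) ≤ (N / δ) ^ 3 := by
      calc (8 : ℝ) ≤ 3 ^ 3 := by norm_num
        _ ≤ (N / δ) ^ 3 := by gcongr; linarith
    calc _ ≤ _ := h3
      _ ≤ (N / δ) ^ 3 * (N / δ) := by gcongr
      _ = _ := by ring

theorem exists_mem_grid {a : ℝ} (ha : 1 ≤ a) {N : ℕ} (hN : 2 * a < 2 ^ N) :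
    ∃ t ∈ grid N, a ≤ t ∧ t ≤ 2 * a := by
  obtain ⟨k, hk1, hk2⟩ := exists_nat_pow_near ha one_lt_two
  have h1 : (2 : ℝ) ^ (k + 1) ≤ 2 * a := by rw [pow_succ]; linarith
  refine ⟨2 ^ (k + 1), ⟨k + 1, ?_, rfl⟩, hk2.le, h1⟩
  exact ((pow_lt_pow_iff_right₀ one_lt_two).mp (h1.trans_lt hN)).le

end Assembly

end CVSVT

theorem theorem7 :
    ∀ c : ℝ, 0 < c → ∃ C : ℝ, 0 < C ∧
      ∀ (δ : ℝ), 0 < δ →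
      ∀ (Ω : Type*) [MeasurableSpace Ω] (μ : Measure Ω) [IsProbabilityMeasure μ] (n N : ℕ) (σ : ℝ)
        (θ : Matrix (Fin n) (Fin n) ℝ)
        (ε : Fin n → Fin n → Ω → ℝ) (W : Fin n → Fin n → Ω → Bool),
        0 ≤ σ →
        CVSVT.IsModel μ σ ε W →
        c ≤ (CVSVT.maxAbs θ + σ) * √(n : ℝ) →
        C * (CVSVT.maxAbs θ + σ) * √(n : ℝ) < 2 ^ N →
        μ {ω | ¬ ∀ est, CVSVT.IsCVSVT N (CVSVT.fold W ω) (CVSVT.observed θ ε ω) est →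
            CVSVT.frobSq (est - θ) / (n : ℝ) ^ 2 ≤
              C / (n : ℝ) ^ 2 *
                  ∑ j, min ((n : ℝ) * (CVSVT.maxAbs θ + σ) ^ 2) (CVSVT.singularValue θ j ^ 2)
                + C / (n : ℝ) ^ 2 * (σ ^ 2 * Real.log ((N : ℝ) / δ))}
          ≤ ENNReal.ofReal (2 * Real.exp (-(n : ℝ)) + δ) := by
  intro c hc
  -- The value 128 meets the operator norm requirement on `t₀`; `1 / c` ensures `K q ≥ 1`, so that
  -- the grid, which starts at 1, has a point between `K q` and `2 K q`.
  set K : ℝ := max 128 (1 / c) with hK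
  have hK128 : 128 ≤ K := le_max_left _ _
  have hKc : 1 ≤ K * c := by
    rw [← div_le_iff₀ hc]
    exact le_max_right _ _
  have hC0 : 0 < 10240 * K ^ 2 + 1536 + 4 / c := by positivity
  -- Here `10240 K² = 2560 * 4 K²` comes from replacing `t₀` by `2 K q` in the oracle error, `1536 =
  -- 96 * 4 * 4` from the selection cost with its logarithm, and `4 / c` forces `2 ^ N > 4`, hence
  -- `N ≥ 3`.
  refine ⟨10240 * K ^ 2 + 1536 + 4 / c, hC0, ?_⟩
  set C : ℝ := 10240 * K ^ 2 + 1536 + 4 / c with hC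
  intro δ hδ Ω _ μ _ n N σ θ ε W hσ hM hcq hCq
  rcases le_or_gt 1 δ with hδ1 | hδ1
  · refine prob_le_one.trans ?_
    rw [← ENNReal.ofReal_one]
    exact ENNReal.ofReal_le_ofReal (by linarith [Real.exp_pos (-(n : ℝ))])
  have h4c : 0 < 4 / c := by positivity
  have hn : 1 ≤ n := by
    rcases Nat.eq_zero_or_pos n with rfl | h
    · simp at hcq; linarith
    · exact h
  set m := CVSVT.maxAbs θ + σ with hm
  set q := m * √(n : ℝ) with hq
  have hq0 : 0 < q := hc.trans_le hcq
  have hCq' : C * q < 2 ^ N := by rwa [hq, ← mul_assoc]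
  have hN3 : 3 ≤ N := by
    have h1 : (2 : ℝ) ^ 2 < 2 ^ N := by
      calc (2 : ℝ) ^ 2 = 4 / c * c := by field_simp; norm_num
        _ ≤ C * q := by gcongr; rw [hC]; nlinarith
        _ < _ := hCq'
    exact (pow_lt_pow_iff_right₀ one_lt_two).mp h1
  obtain ⟨t₀, ht₀, hKt, htK⟩ := CVSVT.exists_mem_grid (a := K * q) (N := N)
    (hKc.trans (by gcongr)) (by
      refine lt_of_le_of_lt ?_ hCq'
      rw [← mul_assoc]
      gcongr
      rw [hC]
      nlinarith)
  have ht₀' : 0 < t₀ := lt_of_lt_of_le (by positivity) hKt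
  obtain ⟨T, hcard, hT1, hT⟩ := CVSVT.exists_half_net n
  -- Chosen so that two folds, `N + 1` grid points and two-sided tails together cost exactly `δ`.
  set L := Real.log (4 * (N + 1) / δ) with hL
  obtain ⟨hL0, hL4⟩ := CVSVT.log_le_four_mul_log hN3 hδ hδ1
  rw [← hL] at hL0 hL4
  have hexp : 4 * ((N : ℝ) + 1) * Real.exp (-L) = δ := by
    rw [Real.exp_neg, hL, Real.exp_log (by positivity)]
    field_simp
  have hb1 := CVSVT.measure_noiseBad_le hσ hM hn hcard hT1 N ht₀' θ hL0
  have hb2 := CVSVT.measure_signalBad_le hM hn hcard hT1 θ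
  rw [hexp] at hb1
  refine (measure_mono (t := _ ∪ _) fun ω hω => ?_).trans
    ((measure_union_le _ _).trans ((add_le_add hb1 hb2).trans_eq ?_))
  · by_contra hgood
    simp only [Set.mem_union, not_or, Set.mem_ofPred_eq] at hgood
    refine hω fun est hest => ?_
    have h := CVSVT.frobSq_sub_le_of_not_bad hσ hT ht₀ ht₀' (by nlinarith) (by positivity)
      hgood.2 hgood.1 hest
    have hsum := CVSVT.sum_min_sq_le (Nat.cast_nonneg n) (by linarith) ht₀'.le htK
      (CVSVT.singularValue θ)
    set D := ∑ j, min ((n : ℝ) * m ^ 2) (CVSVT.singularValue θ j ^ 2)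
    have hD0 : 0 ≤ D := Finset.sum_nonneg fun j _ => by positivity
    have hlog : 0 ≤ Real.log (N / δ) := by linarith
    have hfin : CVSVT.frobSq (est - θ) ≤ C * D + C * (σ ^ 2 * Real.log (N / δ)) := by
      have e1 : 10240 * K ^ 2 * D ≤ C * D := by
        gcongr
        rw [hC]
        linarith
      have e2 : 1536 * (σ ^ 2 * Real.log (N / δ)) ≤ C * (σ ^ 2 * Real.log (N / δ)) := by
        gcongr
        rw [hC]
        nlinarith
      have e3 : σ ^ 2 * L ≤ σ ^ 2 * (4 * Real.log (N / δ)) := by gcongr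
      linarith
    calc CVSVT.frobSq (est - θ) / (n : ℝ) ^ 2
        ≤ (C * D + C * (σ ^ 2 * Real.log (N / δ))) / (n : ℝ) ^ 2 := by gcongr
      _ = _ := by ring
  · rw [← ENNReal.ofReal_add (by positivity) (by positivity)]
    congr 1
    ring
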